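/- Let $q=e^{2\pi i\tau}$ with $\tau$ in the upper half plane, let $E_2 = 1-24\sum_{k\ge1}\sigma_1(k)q^k$, let $E_4 = 1+240\sum_{k\ge1}\sigma_3(k)q^k$, let $\Delta = q\prod_{k\ge1}(1-q^k)^{24}$ and $j = E_4^3/\Delta$. For $w,r\in\mathbb{Z}$, let $QM_w^{(r)}$ be the space of quasimodular forms on $SL_2(\mathbb{Z})$ of weight $w$ and depth at most $r$, i.e. of the functions $\sum_{\ell=0}^{r}E_2^{\ell}f_\ell$ with $f_\ell$ a modular form of weight $w-2\ell$ on $SL_2(\mathbb{Z})$ ($QM_w^{(-1)}=0$). A normalized extremal quasimodular form of weight $w$ and depth $r$ is a function $f\in QM_w^{(r)}\setminus QM_w^{(r-1)}$ with $f=q^{m-1}+O(q^{m})$, where $m=\dim_{\mathbb{C}}QM_w^{(r)}$. For every even integer $w\ge 2$ with $w\ne4$ there is exactly one normalized extremal quasimodular form $G_w^{(1)}$ of weight $w$ and depth $1$. Put also, by convention, $G_0^{(1)}=1$ and $G_4^{(1)}=E_4$ (there are no forms of exact depth $1$ in weights $0$ and $4$). For $n\ge0$ let $$P_n(t)={}_2F_1\left(\tfrac1{12},\tfrac5{12};1;1728t\right)\,{}_2F_1\left(\tfrac{6n+1}{12},\tfrac{6n+5}{12};n+1;1728t\right),$$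 $$Q_n(t)={}_2F_1\left(\tfrac1{12},\tfrac5{12};1;1728t\right)\,{}_2F_1\left(\tfrac{6n-1}{12},\tfrac{6n+7}{12};n+1;1728t\right).$$ Then there is a constant $Y$ such that for all $\tau$ with $\operatorname{Im}\tau>Y$ one has $|j(\tau)|>1728$ and, for all integers $n\ge0$, $$G_{6n}^{(1)}(\tau)=j(\tau)^{-n}\,{}_2F_1\left(\tfrac1{12},\tfrac5{12};1;\tfrac{1728}{j(\tau)}\right)^{2(3n-1)}P_n\left(\tfrac1{j(\tau)}\right),$$ $$G_{6n+2}^{(1)}(\tau)=j(\tau)^{-n}\,{}_2F_1\left(\tfrac1{12},\tfrac5{12};1;\tfrac{1728}{j(\tau)}\right)^{6n}Q_n\left(\tfrac1{j(\tau)}\right).$$ Moreover, for all integers $n\ge0$ and all $\tau$ in the upper half plane, $G_{6n+4}^{(1)}(\tau)=E_4(\tau)\,G_{6n}^{(1)}(\tau)$. -/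

import Mathlib

open UpperHalfPlane hiding I
open scoped MatrixGroups

noncomputable section

/-- The space `QM_w^{(r)}` of quasimodular forms of weight `w` and depth at most `r` on
`SL(2, ℤ)`: the functions `∑_{0 ≤ ℓ ≤ r} E₂ ^ ℓ * f_ℓ` on the upper half plane, where `f_ℓ` is a
modular form of weight `w - 2 ℓ` and level one. It is zero for `r = -1`. -/
def quasimodularForms (w r : ℤ) : Submodule ℂ (ℍ → ℂ) where
  carrier := {f | ∃ g : (l : Fin (r + 1).toNat) → ModularForm 𝒮ℒ (w - 2 * (l : ℕ)),
    ∀ τ, f τ = ∑ l : Fin (r + 1).toNat, EisensteinSeries.E2 τ ^ (l : ℕ) * g l τ}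
  add_mem' := by
    rintro a b ⟨g, hg⟩ ⟨h, hh⟩
    exact ⟨fun l => g l + h l, fun τ => by
      simp [hg, hh, mul_add, Finset.sum_add_distrib]⟩
  zero_mem' := ⟨fun _ => 0, fun τ => by simp⟩
  smul_mem' := by
    rintro c a ⟨g, hg⟩
    exact ⟨fun l => c • g l, fun τ => by
      simp [hg, Finset.mul_sum, mul_left_comm]⟩

/-- `f` is a normalized extremal quasimodular form of weight `w` and (exact) depth `r`: it lies in
`QM_w^{(r)}` but not in `QM_w^{(r-1)}`, and with `m = dim QM_w^{(r)}` its expansion in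
`q = exp (2 π i τ)` is `q ^ (m - 1) + O(q ^ m)`. -/
structure IsNormalizedExtremal (w r : ℤ) (f : ℍ → ℂ) : Prop where
  mem : f ∈ quasimodularForms w r
  notMem : f ∉ quasimodularForms w (r - 1)
  order_add_one : (qExpansion 1 f).order + 1 = Module.finrank ℂ (quasimodularForms w r)
  leadingCoeff : (qExpansion 1 f).coeff (Module.finrank ℂ (quasimodularForms w r) - 1) = 1

/-- The elliptic modular function `j = E₄ ^ 3 / Δ`. -/
def jInvariant (τ : ℍ) : ℂ := ModularForm.E₄ τ ^ 3 / ModularForm.discriminant τ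

/-- `P_n(t) = ₂F₁(1/12, 5/12; 1; 1728 t) * ₂F₁((6n+1)/12, (6n+5)/12; n+1; 1728 t)`. -/
def hypergeometricP (n : ℕ) (t : ℂ) : ℂ :=
  ₂F₁ (1 / 12 : ℂ) (5 / 12) 1 (1728 * t) *
    ₂F₁ ((6 * n + 1) / 12 : ℂ) ((6 * n + 5) / 12) (n + 1) (1728 * t)

/-- `Q_n(t) = ₂F₁(1/12, 5/12; 1; 1728 t) * ₂F₁((6n-1)/12, (6n+7)/12; n+1; 1728 t)`. -/
def hypergeometricQ (n : ℕ) (t : ℂ) : ℂ :=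
  ₂F₁ (1 / 12 : ℂ) (5 / 12) 1 (1728 * t) *
    ₂F₁ ((6 * n - 1) / 12 : ℂ) ((6 * n + 7) / 12) (n + 1) (1728 * t)

end

/-! Write D = q d/dq and ϑ_k = D − (k/12)E₂. Forms of weight w and depth at most one are the sums A
+ E₂B, and ϑ_{w-1} raises their weight by 2 without raising the depth bound. For f = A + E₂B the
expression f·DB − B·Df + f²/12 is a genuine modular form of weight 2w, so the Sturm bound forces f =
0 as soon as f vanishes beyond order ⌊w/6⌋ (`eq_zero_of_mem_quasimodularForms`). For even w the
dimension is ⌊w/6⌋ + 1, hence the first ⌊w/6⌋ + 1 coefficients can be prescribed freely and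
determine the form. This gives existence and uniqueness.

Comparing leading coefficients then identifies G_{6n+4} with E₄G_{6n}, G_{6n+2} with
(12/(6n+1))ϑ_{6n-1}G_{6n}, and yields the Kaneko–Zagier equation ϑ_{6n+1}ϑ_{6n-1}G_{6n} =
((36n²−1)/144)E₄G_{6n} (`serreDerivative_serreDerivative`).

Near q = 0 put x = 1728/j. Since D(1/j) = (1/j)E₆/E₄ and (E₆/E₄)² = (1−x)E₄, Gauss's equation in x
shows that j⁻ⁿE₄^{(6n∓1)/4}₂F₁(x), with the parameters of P_n and Q_n respectively, satisfies the
same first order system in q as G_{6n} and G_{6n+2}. The exponents at q = 0 are 0 and n, so two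
solutions agreeing through order n coincide (`cuspFunction_eq_candidate`,
`cuspFunction_eq_candidate'`). The case n = 0, where G₀ = 1, says that E₄^{1/4} is itself ₂F₁(1/12,
5/12; 1; x); this replaces the powers of E₄ by powers of that series. -/

open Function Filter Topology Manifold Derivative

/-! ### Functions holomorphic at the cusp and their q-expansions. -/

/-- Functions on the upper half plane that are holomorphic, invariant under `τ ↦ τ + 1` and bounded
at `i∞`. -/
structure IsHolomorphicAtCusp (f : ℍ → ℂ) : Prop where
  periodic : Periodic (f ∘ ofComplex) (1 : ℝ)
  mdiff : MDiff f
  bounded : IsBoundedAtImInfty f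

lemma periodic_comp_ofComplex_of_vadd {f : ℍ → ℂ} (h : ∀ τ : ℍ, f ((1 : ℝ) +ᵥ τ) = f τ) :
    Periodic (f ∘ ofComplex) (1 : ℝ) := by
  intro w
  by_cases! hw : 0 < w.im
  · have hw' : 0 < (w + (1 : ℝ)).im := by simp [hw]
    simp only [comp_apply, ofComplex_apply_of_im_pos hw, ofComplex_apply_of_im_pos hw']
    rw [← h ⟨w, hw⟩]
    congr 1
    ext
    simp [add_comm w]
  · have hw' : (w + (1 : ℝ)).im ≤ 0 := by simpa using hw
    simp only [comp_apply, ofComplex_apply_of_im_nonpos hw, ofComplex_apply_of_im_nonpos hw']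

lemma qParam_one_vadd (τ : ℍ) :
    Periodic.qParam 1 (((1 : ℝ) +ᵥ τ : ℍ) : ℂ) = Periodic.qParam 1 τ := by
  rw [Periodic.qParam, Periodic.qParam, coe_vadd,
    ← Complex.exp_periodic (2 * Real.pi * Complex.I * τ / (1 : ℝ))]
  congr 1
  push_cast
  ring

namespace IsHolomorphicAtCusp

variable {f g : ℍ → ℂ}

lemma add (hf : IsHolomorphicAtCusp f) (hg : IsHolomorphicAtCusp g) :
    IsHolomorphicAtCusp (f + g) :=
  ⟨hf.periodic.add hg.periodic, hf.mdiff.add hg.mdiff, hf.bounded.add hg.bounded⟩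

lemma mul (hf : IsHolomorphicAtCusp f) (hg : IsHolomorphicAtCusp g) :
    IsHolomorphicAtCusp (f * g) :=
  ⟨hf.periodic.mul hg.periodic, hf.mdiff.mul hg.mdiff, hf.bounded.mul hg.bounded⟩

lemma smul (c : ℂ) (hf : IsHolomorphicAtCusp f) : IsHolomorphicAtCusp (c • f) :=
  ⟨hf.periodic.smul c, hf.mdiff.const_smul c, hf.bounded.smul c⟩

lemma sub (hf : IsHolomorphicAtCusp f) (hg : IsHolomorphicAtCusp g) :
    IsHolomorphicAtCusp (f - g) := by
  simpa [sub_eq_add_neg] using hf.add (hg.smul (-1))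

lemma modularForm {k : ℤ} (f : ModularForm 𝒮ℒ k) : IsHolomorphicAtCusp f :=
  ⟨SlashInvariantFormClass.periodic_comp_ofComplex f one_mem_strictPeriods_SL,
    ModularFormClass.holo f, ModularFormClass.bdd_at_infty f⟩

lemma E2 : IsHolomorphicAtCusp EisensteinSeries.E2 := by
  refine ⟨periodic_comp_ofComplex_of_vadd fun τ => ?_, E2_mdifferentiable,
    EisensteinSeries.isBoundedAtImInfty_E2⟩
  have h (z : ℍ) : Complex.exp (2 * Real.pi * Complex.I * z) = Periodic.qParam 1 z := by
    simp [Periodic.qParam]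
  simp only [EisensteinSeries.E2_eq_tsum_cexp, h, qParam_one_vadd]

lemma differentiableOn (hf : IsHolomorphicAtCusp f) :
    DifferentiableOn ℂ (cuspFunction 1 f) (Metric.ball 0 1) :=
  differentiableOn_cuspFunction_ball one_pos hf.periodic hf.mdiff hf.bounded

lemma analyticAt_zero (hf : IsHolomorphicAtCusp f) : AnalyticAt ℂ (cuspFunction 1 f) 0 :=
  analyticAt_cuspFunction_zero one_pos hf.periodic hf.mdiff hf.bounded

lemma cuspFunction_qParam (hf : IsHolomorphicAtCusp f) (τ : ℍ) :
    cuspFunction 1 f (Periodic.qParam 1 τ) = f τ :=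
  eq_cuspFunction τ one_ne_zero hf.periodic

/-- Chain rule for q = exp(2πiτ): the normalization by 2πi turns d/dτ into q d/dq. -/
lemma normalizedDeriv_eq (hf : IsHolomorphicAtCusp f) (τ : ℍ) :
    normalizedDerivOfComplex f τ =
      Periodic.qParam 1 τ * deriv (cuspFunction 1 f) (Periodic.qParam 1 τ) := by
  have hq : ‖Periodic.qParam 1 (τ : ℂ)‖ < 1 := Periodic.norm_qParam_lt_one one_pos τ.im_pos
  have hg : HasDerivAt (cuspFunction 1 f) (deriv (cuspFunction 1 f) (Periodic.qParam 1 τ))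
      (Periodic.qParam 1 τ) :=
    (hf.differentiableOn.differentiableAt
      (Metric.isOpen_ball.mem_nhds (by simpa using hq))).hasDerivAt
  have hp : HasDerivAt (Periodic.qParam 1) (2 * Real.pi * Complex.I * Periodic.qParam 1 τ) τ := by
    have : HasDerivAt (fun z : ℂ => 2 * Real.pi * Complex.I * z / (1 : ℝ))
        (2 * Real.pi * Complex.I) (τ : ℂ) := by
      simpa using (hasDerivAt_id (τ : ℂ)).const_mul (2 * Real.pi * Complex.I)
    exact this.cexp.congr_deriv (mul_comm _ _)
  have hc := hg.comp (τ : ℂ) hp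
  have heq : (f ∘ ofComplex) =ᶠ[𝓝 (τ : ℂ)] cuspFunction 1 f ∘ Periodic.qParam 1 := by
    filter_upwards [isOpen_upperHalfPlaneSet.mem_nhds τ.im_pos] with z hz
    simp only [comp_apply, ofComplex_apply_of_im_pos hz]
    exact (hf.cuspFunction_qParam ⟨z, hz⟩).symm
  rw [normalizedDerivOfComplex, heq.deriv_eq, hc.deriv]
  field_simp

lemma isZeroAtImInfty_normalizedDeriv (hf : IsHolomorphicAtCusp f) :
    IsZeroAtImInfty (normalizedDerivOfComplex f) := by
  have h : Tendsto (fun q : ℂ => q * deriv (cuspFunction 1 f) q) (𝓝 0) (𝓝 0) := by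
    simpa using (tendsto_id (x := 𝓝 (0 : ℂ))).mul hf.analyticAt_zero.deriv.continuousAt.tendsto
  exact (h.comp (qParam_tendsto_atImInfty one_pos)).congr fun τ => (hf.normalizedDeriv_eq τ).symm

lemma normalizedDeriv (hf : IsHolomorphicAtCusp f) :
    IsHolomorphicAtCusp (normalizedDerivOfComplex f) := by
  refine ⟨periodic_comp_ofComplex_of_vadd fun τ => ?_,
    normalizedDerivOfComplex_mdifferentiable hf.mdiff,
    hf.isZeroAtImInfty_normalizedDeriv.isBoundedAtImInfty⟩
  rw [hf.normalizedDeriv_eq, hf.normalizedDeriv_eq, qParam_one_vadd]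

lemma cuspFunction_normalizedDeriv (hf : IsHolomorphicAtCusp f) {q : ℂ} (hq : ‖q‖ < 1) :
    cuspFunction 1 (normalizedDerivOfComplex f) q = q * deriv (cuspFunction 1 f) q := by
  rcases eq_or_ne q 0 with rfl | hq0
  · rw [hf.isZeroAtImInfty_normalizedDeriv.cuspFunction_apply_zero one_pos, zero_mul]
  · have hτ := Periodic.im_invQParam_pos_of_norm_lt_one one_pos hq hq0
    have h1 := hf.normalizedDeriv.cuspFunction_qParam ⟨_, hτ⟩
    rw [hf.normalizedDeriv_eq] at h1
    simpa [Periodic.qParam_right_inv one_ne_zero hq0] using h1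

lemma qExpansion_add (hf : IsHolomorphicAtCusp f) (hg : IsHolomorphicAtCusp g) :
    qExpansion 1 (f + g) = qExpansion 1 f + qExpansion 1 g :=
  UpperHalfPlane.qExpansion_add hf.analyticAt_zero hg.analyticAt_zero

lemma qExpansion_sub (hf : IsHolomorphicAtCusp f) (hg : IsHolomorphicAtCusp g) :
    qExpansion 1 (f - g) = qExpansion 1 f - qExpansion 1 g :=
  UpperHalfPlane.qExpansion_sub hf.analyticAt_zero hg.analyticAt_zero

lemma qExpansion_mul (hf : IsHolomorphicAtCusp f) (hg : IsHolomorphicAtCusp g) :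
    qExpansion 1 (f * g) = qExpansion 1 f * qExpansion 1 g :=
  UpperHalfPlane.qExpansion_mul hf.analyticAt_zero hg.analyticAt_zero

lemma qExpansion_smul (c : ℂ) (hf : IsHolomorphicAtCusp f) :
    qExpansion 1 (c • f) = c • qExpansion 1 f :=
  UpperHalfPlane.qExpansion_smul hf.analyticAt_zero c

lemma qExpansion_eq_zero_iff (hf : IsHolomorphicAtCusp f) : qExpansion 1 f = 0 ↔ f = 0 :=
  UpperHalfPlane.qExpansion_eq_zero_iff one_pos hf.periodic hf.mdiff hf.bounded

end IsHolomorphicAtCusp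

/-! ### Taylor series at 0 as formal power series. -/

/-- The Taylor series at `0`, as a formal power series. -/
noncomputable def taylorAtZero (f : ℂ → ℂ) : PowerSeries ℂ :=
  .mk fun m => (m.factorial : ℂ)⁻¹ * iteratedDeriv m f 0

lemma qExpansion_eq_taylorAtZero (f : ℍ → ℂ) :
    qExpansion 1 f = taylorAtZero (cuspFunction 1 f) := rfl

lemma taylorAtZero_congr {f g : ℂ → ℂ} (h : f =ᶠ[𝓝 0] g) : taylorAtZero f = taylorAtZero g := by
  ext m
  simp [taylorAtZero, h.iteratedDeriv_eq m]

lemma coeff_zero_taylorAtZero (f : ℂ → ℂ) : (taylorAtZero f).coeff 0 = f 0 := by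
  simp [taylorAtZero]

lemma taylorAtZero_deriv (f : ℂ → ℂ) :
    taylorAtZero (deriv f) = PowerSeries.derivative ℂ (taylorAtZero f) := by
  ext m
  rw [PowerSeries.coeff_derivative]
  simp only [taylorAtZero, PowerSeries.coeff_mk, iteratedDeriv_succ', Nat.factorial_succ]
  have : (m.factorial : ℂ) ≠ 0 := mod_cast m.factorial_ne_zero
  have : (m : ℂ) + 1 ≠ 0 := by exact_mod_cast m.succ_ne_zero
  push_cast
  field_simp

lemma taylorAtZero_mul {f g : ℂ → ℂ} (hf : AnalyticAt ℂ f 0) (hg : AnalyticAt ℂ g 0) :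
    taylorAtZero (f * g) = taylorAtZero f * taylorAtZero g := by
  ext
  simp only [taylorAtZero, PowerSeries.coeff_mk,
    iteratedDeriv_mul hf.contDiffAt hg.contDiffAt, Finset.mul_sum, PowerSeries.coeff_mul,
    Finset.Nat.sum_antidiagonal_eq_sum_range_succ_mk, Nat.succ_eq_add_one]
  refine Finset.sum_congr rfl fun i hi ↦ ?_
  rw [Nat.cast_choose _ (by grind)]
  field_simp [Nat.factorial_ne_zero]

lemma taylorAtZero_add {f g : ℂ → ℂ} (hf : AnalyticAt ℂ f 0) (hg : AnalyticAt ℂ g 0) :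
    taylorAtZero (f + g) = taylorAtZero f + taylorAtZero g := by
  ext
  simp [taylorAtZero, iteratedDeriv_add hf.contDiffAt hg.contDiffAt, mul_add]

lemma taylorAtZero_const_mul (c : ℂ) {f : ℂ → ℂ} :
    taylorAtZero (fun z => c * f z) = c • taylorAtZero f := by
  ext m
  have : iteratedDeriv m (fun z => c * f z) 0 = c * iteratedDeriv m f 0 :=
    iteratedDeriv_const_smul_field c f
  simp only [taylorAtZero, PowerSeries.coeff_mk, PowerSeries.coeff_smul, smul_eq_mul, this]
  ring

lemma taylorAtZero_of_hasFPowerSeriesAt {f : ℂ → ℂ} {c : ℕ → ℂ}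
    (h : HasFPowerSeriesAt f (.ofScalars ℂ c) 0) : taylorAtZero f = .mk c := by
  ext m
  have := congr_arg (FormalMultilinearSeries.coeff · m)
    (h.analyticAt.hasFPowerSeriesAt.eq_formalMultilinearSeries h)
  simpa [taylorAtZero, FormalMultilinearSeries.coeff_ofScalars, div_eq_mul_inv, mul_comm]
    using this

lemma taylorAtZero_id : taylorAtZero (fun z => z) = PowerSeries.X := by
  ext m
  rcases m with _ | _ | m
  · simp [taylorAtZero]
  · simp [taylorAtZero, PowerSeries.coeff_X]
  · have : iteratedDeriv (m + 1 + 1) (fun z : ℂ => z) 0 = 0 := by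
      simp [iteratedDeriv_succ', iteratedDeriv_const]
    simp [taylorAtZero, PowerSeries.coeff_X, this]

lemma eventuallyEq_zero_of_taylorAtZero_eq_zero {f : ℂ → ℂ} (hf : AnalyticAt ℂ f 0)
    (h : taylorAtZero f = 0) : f =ᶠ[𝓝 0] 0 := by
  have h1 := hf.hasFPowerSeriesAt
  have h2 : (FormalMultilinearSeries.ofScalars ℂ
      fun n => iteratedDeriv n f 0 / (n.factorial : ℂ)) = 0 := by
    have : (fun n => iteratedDeriv n f 0 / (n.factorial : ℂ)) = 0 := by
      ext n
      have := congr_arg (PowerSeries.coeff n) h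
      simpa [taylorAtZero, div_eq_mul_inv, mul_comm] using this
    rw [this]
    simp
  rw [h2] at h1
  exact h1.eventually_eq_zero

lemma IsHolomorphicAtCusp.qExpansion_normalizedDeriv {f : ℍ → ℂ} (hf : IsHolomorphicAtCusp f) :
    qExpansion 1 (normalizedDerivOfComplex f) =
      PowerSeries.X * PowerSeries.derivative ℂ (qExpansion 1 f) := by
  have h : cuspFunction 1 (normalizedDerivOfComplex f) =ᶠ[𝓝 0]
      (fun z => z) * deriv (cuspFunction 1 f) := by
    filter_upwards [Metric.ball_mem_nhds (0 : ℂ) one_pos] with q hq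
    exact hf.cuspFunction_normalizedDeriv (by simpa using hq)
  rw [qExpansion_eq_taylorAtZero, qExpansion_eq_taylorAtZero, taylorAtZero_congr h,
    taylorAtZero_mul (f := fun z => z) analyticAt_id hf.analyticAt_zero.deriv, taylorAtZero_id,
    taylorAtZero_deriv]
-- Serre derivatives and Ramanujan's identities.
open EisensteinSeries ModularForm

/-- A function that is holomorphic at the cusp and invariant under the weight `k` action of
`SL(2, ℤ)` is a modular form of level one. -/
noncomputable def ModularForm.ofHolomorphicAtCusp {k : ℤ} (f : ℍ → ℂ) (hf : IsHolomorphicAtCusp f)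
    (h : ∀ γ : SL(2, ℤ), f ∣[k] γ = f) : ModularForm 𝒮ℒ k where
  toFun := f
  slash_action_eq' := fun _ ⟨γ, hγ⟩ => hγ ▸ h γ
  holo' := hf.mdiff
  bdd_at_cusps' {c} hc := by
    rw [Subgroup.IsArithmetic.isCusp_iff_isCusp_SL2Z] at hc
    rw [OnePoint.isBoundedAt_iff_forall_SL2Z hc]
    intro γ _
    rw [h γ]
    exact hf.bounded

lemma ModularForm.slash_SL_eq {k : ℤ} (f : ModularForm 𝒮ℒ k) (γ : SL(2, ℤ)) :
    (f : ℍ → ℂ) ∣[k] γ = f :=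
  SlashInvariantForm.slash_action_eqn f _ ⟨γ, rfl⟩

lemma IsHolomorphicAtCusp.serreDerivative {f : ℍ → ℂ} (k : ℂ) (hf : IsHolomorphicAtCusp f) :
    IsHolomorphicAtCusp (serreDerivative k f) := by
  have h := hf.normalizedDeriv.sub ((IsHolomorphicAtCusp.E2.mul hf).smul (k * 12⁻¹))
  convert h using 1
  ext τ
  simp [serreDerivative_apply]
  ring

/-- The Serre derivative of a modular form of level one. -/
noncomputable def ModularForm.serre {k : ℤ} (f : ModularForm 𝒮ℒ k) : ModularForm 𝒮ℒ (k + 2) :=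
  ModularForm.ofHolomorphicAtCusp (serreDerivative k f)
    ((IsHolomorphicAtCusp.modularForm f).serreDerivative k)
    fun γ => serreDerivative_slash_invariant (ModularFormClass.holo f) (f.slash_SL_eq γ)

lemma ModularForm.serre_apply {k : ℤ} (f : ModularForm 𝒮ℒ k) (τ : ℍ) :
    f.serre τ = normalizedDerivOfComplex f τ - k * 12⁻¹ * EisensteinSeries.E2 τ * f τ := rfl

lemma normalizedDerivOfComplex_div_denom (γ : SL(2, ℤ)) :
    normalizedDerivOfComplex (fun z : ℍ => (γ 1 0 : ℂ) / denom γ z) =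
      fun z : ℍ => -(2 * Real.pi * Complex.I)⁻¹ * ((γ 1 0 : ℂ) / denom γ z) ^ 2 := by
  ext z
  have h1 : HasDerivAt (fun w : ℂ => (γ 1 0 : ℂ) * w + γ 1 1) (γ 1 0) z := by
    simpa using ((hasDerivAt_id (z : ℂ)).const_mul (γ 1 0 : ℂ)).add_const (γ 1 1 : ℂ)
  have hd (w : ℍ) : denom γ w = (γ 1 0 : ℂ) * w + γ 1 1 := ModularGroup.denom_apply γ w
  have hne : (γ 1 0 : ℂ) * z + γ 1 1 ≠ 0 := hd z ▸ denom_ne_zero γ z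
  have h2 := (hasDerivAt_const (z : ℂ) (γ 1 0 : ℂ)).div h1 hne
  have heq : ((fun z : ℍ => (γ 1 0 : ℂ) / denom γ z) ∘ ofComplex) =ᶠ[𝓝 (z : ℂ)]
      fun w => (γ 1 0 : ℂ) / ((γ 1 0 : ℂ) * w + γ 1 1) := by
    filter_upwards [isOpen_upperHalfPlaneSet.mem_nhds z.im_pos] with w hw
    simp only [comp_apply, ofComplex_apply_of_im_pos hw, hd]
  have h3 : deriv (fun w : ℂ => (γ 1 0 : ℂ) / ((γ 1 0 : ℂ) * w + γ 1 1)) z = _ := h2.deriv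
  rw [normalizedDerivOfComplex, heq.deriv_eq, h3, hd]
  field_simp
  ring

lemma E2_slash (γ : SL(2, ℤ)) : EisensteinSeries.E2 ∣[(2 : ℤ)] γ =
    EisensteinSeries.E2 + (12 * (2 * Real.pi * Complex.I)⁻¹ : ℂ) •
      fun z : ℍ => (γ 1 0 : ℂ) / denom γ z := by
  rw [E2_slash_action]
  ext z
  have hpi : (Real.pi : ℂ) ≠ 0 := by exact_mod_cast Real.pi_ne_zero
  simp only [Pi.sub_apply, Pi.add_apply, Pi.smul_apply, smul_eq_mul, D2, riemannZeta_two]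
  have : denom γ z ≠ 0 := denom_ne_zero γ z
  field_simp
  linear_combination (-12 * (γ 1 0 : ℂ)) * Complex.I_sq

/-- The anomaly ε = (12/2πi)·c/(cz+d) of E₂ satisfies Dε = −ε²/12. Hence (DE₂)|γ differs from DE₂ by
((E₂+ε)² − E₂²)/12, which is exactly the change of E₂²/12. -/
lemma serreDerivative_one_E2_slash (γ : SL(2, ℤ)) :
    serreDerivative 1 EisensteinSeries.E2 ∣[(4 : ℤ)] γ =
      serreDerivative 1 EisensteinSeries.E2 := by
  have h1 := normalizedDerivOfComplex_SL_slash (k := 2) E2_mdifferentiable (γ := γ)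
  have hm : MDiff fun z : ℍ => (γ 1 0 : ℂ) / denom γ z := by
    simp only [div_eq_mul_inv]
    exact mdifferentiable_const.mul (mdifferentiable_inv_denom (γ : GL (Fin 2) ℝ))
  rw [E2_slash, normalizedDerivOfComplex_add _ _ E2_mdifferentiable (hm.const_smul _),
    normalizedDerivOfComplex_smul _ _ hm, normalizedDerivOfComplex_div_denom] at h1
  ext z
  have h2 := congrFun h1 z
  have h3 := congrFun (mul_slash_SL2 2 2 γ EisensteinSeries.E2 EisensteinSeries.E2) z
  rw [E2_slash] at h3
  have h4 : (serreDerivative 1 EisensteinSeries.E2 ∣[(4 : ℤ)] γ) z =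
      (normalizedDerivOfComplex EisensteinSeries.E2 ∣[(4 : ℤ)] γ) z -
        12⁻¹ * ((EisensteinSeries.E2 * EisensteinSeries.E2) ∣[(2 + 2 : ℤ)] γ) z := by
    simp only [SL_slash_apply, serreDerivative_apply, Pi.mul_apply]
    norm_num
    ring
  rw [h4, h3]
  simp only [Pi.sub_apply, Pi.add_apply, Pi.smul_apply, Pi.mul_apply, smul_eq_mul,
    serreDerivative_apply] at h2 ⊢
  norm_num at h2 ⊢
  linear_combination -h2

lemma qExpansion_E2_coeff_zero : (qExpansion 1 EisensteinSeries.E2).coeff 0 = 1 := by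
  have h := hasFPowerSeriesOnBall_cuspFunction (f := EisensteinSeries.E2)
    (c := fun m => if m = 0 then 1 else -24 * ArithmeticFunction.sigma 1 m) one_pos
    IsHolomorphicAtCusp.E2.analyticAt_zero fun τ => by
      simpa [Periodic.qParam] using hasSum_qExpansion_E2 (z := τ)
  rw [qExpansion_eq_taylorAtZero, taylorAtZero_of_hasFPowerSeriesAt h.hasFPowerSeriesAt,
    PowerSeries.coeff_mk, if_pos rfl]

lemma IsHolomorphicAtCusp.qExpansion_serreDerivative {f : ℍ → ℂ} (k : ℂ)
    (hf : IsHolomorphicAtCusp f) : qExpansion 1 (Derivative.serreDerivative k f) =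
      PowerSeries.X * PowerSeries.derivative ℂ (qExpansion 1 f) -
        (k * 12⁻¹) • (qExpansion 1 EisensteinSeries.E2 * qExpansion 1 f) := by
  have h : Derivative.serreDerivative k f =
      normalizedDerivOfComplex f - (k * 12⁻¹) • (EisensteinSeries.E2 * f) := by
    ext τ
    simp [serreDerivative_apply]
    ring
  have hE := IsHolomorphicAtCusp.E2.mul hf
  rw [h, hf.normalizedDeriv.qExpansion_sub (hE.smul _), hE.qExpansion_smul,
    IsHolomorphicAtCusp.E2.qExpansion_mul hf, hf.qExpansion_normalizedDeriv]

lemma IsHolomorphicAtCusp.qExpansion_serreDerivative_coeff_zero {f : ℍ → ℂ} (k : ℂ)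
    (hf : IsHolomorphicAtCusp f) : (qExpansion 1 (Derivative.serreDerivative k f)).coeff 0 =
      -(k * 12⁻¹) * (qExpansion 1 f).coeff 0 := by
  rw [hf.qExpansion_serreDerivative]
  have := qExpansion_E2_coeff_zero
  simp [PowerSeries.coeff_mul, -PowerSeries.coeff_zero_eq_constantCoeff, this]

lemma ModularForm.apply_eq_of_rank_eq_one {k : ℤ} (h : Module.rank ℂ (ModularForm 𝒮ℒ k) = 1)
    {g : ModularForm 𝒮ℒ k} (hg : (qExpansion 1 g).coeff 0 = 1) (f : ModularForm 𝒮ℒ k) (τ : ℍ) :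
    f τ = (qExpansion 1 f).coeff 0 * g τ := by
  have hg0 : g ≠ 0 := by
    rintro rfl
    simp [qExpansion_zero] at hg
  obtain ⟨c, rfl⟩ := (finrank_eq_one_iff_of_nonzero' g hg0).mp
    (Module.rank_eq_one_iff_finrank_eq_one.mp h) f
  have : (qExpansion 1 ⇑(c • g)).coeff 0 = c := by
    rw [FunLike.coe_smul, ModularForm.qExpansion_smul one_pos one_mem_strictPeriods_SL,
      PowerSeries.coeff_smul, hg, smul_eq_mul, mul_one]
  rw [this]
  rfl

lemma levelOne_rank_eq_one {k : ℕ} (h3 : 3 ≤ k) (h12 : k < 12) (hk : Even k) :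
    Module.rank ℂ (ModularForm 𝒮ℒ k) = 1 := by
  rw [rank_eq_one_add_rank_cuspForm h3 hk, CuspForm.rank_eq_zero_of_weight_lt_twelve (by lia)]
  simp

/-- M₄ is spanned by E₄, so the constant term −1/12 of ϑ₁E₂ determines it. The next two identities
follow in the same way from dim M₆ = dim M₈ = 1. -/
lemma normalizedDeriv_E2 (τ : ℍ) : normalizedDerivOfComplex EisensteinSeries.E2 τ =
    (EisensteinSeries.E2 τ ^ 2 - E₄ τ) / 12 := by
  have hE := IsHolomorphicAtCusp.E2
  have h := apply_eq_of_rank_eq_one (levelOne_rank_eq_one (by norm_num) (by norm_num) ⟨2, rfl⟩)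
    (g := E₄) (E_qExpansion_coeff_zero _ ⟨2, rfl⟩)
    (ofHolomorphicAtCusp _ (hE.serreDerivative 1) serreDerivative_one_E2_slash) τ
  change serreDerivative 1 EisensteinSeries.E2 τ =
    (qExpansion 1 (serreDerivative 1 EisensteinSeries.E2)).coeff 0 * _ at h
  rw [hE.qExpansion_serreDerivative_coeff_zero, qExpansion_E2_coeff_zero,
    serreDerivative_apply] at h
  linear_combination h

lemma serre_E₄_apply (τ : ℍ) : E₄.serre τ = -E₆ τ / 3 := by
  have h := apply_eq_of_rank_eq_one (levelOne_rank_eq_one (by norm_num) (by norm_num) ⟨3, rfl⟩)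
    (g := E₆) (E_qExpansion_coeff_zero _ ⟨3, rfl⟩) E₄.serre τ
  have h0 : (qExpansion 1 E₄.serre).coeff 0 = _ :=
    (IsHolomorphicAtCusp.modularForm E₄).qExpansion_serreDerivative_coeff_zero _
  rw [h, h0, E_qExpansion_coeff_zero _ ⟨2, rfl⟩]
  push_cast
  ring

lemma serre_E₆_apply (τ : ℍ) : E₆.serre τ = -E₄ τ ^ 2 / 2 := by
  have hg : (qExpansion 1 (E₄.mul E₄)).coeff 0 = 1 := by
    rw [ModularForm.qExpansion_mul one_pos one_mem_strictPeriods_SL]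
    have := E_qExpansion_coeff_zero (k := 4) (by norm_num) ⟨2, rfl⟩
    simp [PowerSeries.coeff_mul, -PowerSeries.coeff_zero_eq_constantCoeff, this]
  have h := apply_eq_of_rank_eq_one (levelOne_rank_eq_one (by norm_num) (by norm_num) ⟨4, rfl⟩)
    (g := E₄.mul E₄) hg E₆.serre τ
  have h0 : (qExpansion 1 E₆.serre).coeff 0 = _ :=
    (IsHolomorphicAtCusp.modularForm E₆).qExpansion_serreDerivative_coeff_zero _
  rw [h, h0, E_qExpansion_coeff_zero _ ⟨3, rfl⟩]
  push_cast
  rw [show E₄.mul E₄ τ = E₄ τ * E₄ τ from rfl]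
  ring

/-! ### Quasimodular forms of depth at most one. -/

lemma mem_quasimodularForms_one {w : ℤ} {f : ℍ → ℂ} : f ∈ quasimodularForms w 1 ↔
    ∃ (A : ModularForm 𝒮ℒ w) (B : ModularForm 𝒮ℒ (w - 2)),
      f = ⇑A + EisensteinSeries.E2 * ⇑B := by
  constructor
  · rintro ⟨g, hg⟩
    refine ⟨mcast (by simp) (g (0 : Fin 2)), mcast (by simp) (g (1 : Fin 2)), ?_⟩
    ext τ
    refine (hg τ).trans ((Fin.sum_univ_two _).trans ?_)
    simp
  · rintro ⟨A, B, rfl⟩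
    refine ⟨Fin.cons (α := fun l : Fin 2 => ModularForm 𝒮ℒ (w - 2 * (l : ℕ)))
      (mcast (by simp) A) fun l => mcast (by simp [Subsingleton.elim l 0]) B, fun τ => ?_⟩
    refine Eq.trans ?_ (Fin.sum_univ_two _).symm
    simp

lemma exists_of_mem_quasimodularForms_zero {w : ℤ} {f : ℍ → ℂ}
    (hf : f ∈ quasimodularForms w (1 - 1)) : ∃ A : ModularForm 𝒮ℒ w, f = A := by
  obtain ⟨g, hg⟩ := hf
  refine ⟨mcast (by simp) (g (0 : Fin 1)), ?_⟩
  ext τ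
  refine (hg τ).trans ((Fin.sum_univ_one _).trans ?_)
  simp

lemma IsHolomorphicAtCusp.of_mem_quasimodularForms {w : ℤ} {f : ℍ → ℂ}
    (hf : f ∈ quasimodularForms w 1) : IsHolomorphicAtCusp f := by
  obtain ⟨A, B, rfl⟩ := mem_quasimodularForms_one.mp hf
  exact (modularForm A).add (E2.mul (modularForm B))

/-- The Serre derivative of weight `w - 1` maps quasimodular forms of weight `w` and depth at most
one to quasimodular forms of weight `w + 2` and depth at most one. -/
lemma serreDerivative_mem_quasimodularForms {w : ℤ} {f : ℍ → ℂ}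
    (hf : f ∈ quasimodularForms w 1) :
    serreDerivative (w - 1) f ∈ quasimodularForms (w + 2) 1 := by
  obtain ⟨A, B, rfl⟩ := mem_quasimodularForms_one.mp hf
  -- The E₂²B terms cancel: DE₂ contributes 1/12, DB contributes (w−2)/12, and the Serre correction
  -- of weight w−1 removes (w−1)/12.
  refine mem_quasimodularForms_one.mpr
    ⟨A.serre - (12⁻¹ : ℂ) • mcast (by ring) (E₄.mul B),
      mcast (by ring) ((12⁻¹ : ℂ) • A) + mcast (by ring) B.serre, ?_⟩
  have hB := ModularFormClass.holo B
  ext τ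
  have h1 := congrFun (normalizedDerivOfComplex_add _ _ (ModularFormClass.holo A)
    (E2_mdifferentiable.mul hB)) τ
  have h2 := congrFun (normalizedDerivOfComplex_mul _ _ E2_mdifferentiable hB) τ
  simp only [Pi.add_apply, Pi.mul_apply] at h1 h2
  simp only [serreDerivative_apply, Pi.add_apply, Pi.mul_apply, _root_.sub_apply,
    _root_.add_apply, ModularForm.coe_mcast, _root_.smul_apply, smul_eq_mul,
    serre_apply, h1, h2, normalizedDeriv_E2, show E₄.mul B τ = E₄ τ * B τ from rfl]
  push_cast
  ring

lemma E₄_mul_mem_quasimodularForms {w : ℤ} {f : ℍ → ℂ} (hf : f ∈ quasimodularForms w 1) :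
    ⇑E₄ * f ∈ quasimodularForms (w + 4) 1 := by
  obtain ⟨A, B, rfl⟩ := mem_quasimodularForms_one.mp hf
  refine mem_quasimodularForms_one.mpr
    ⟨mcast (by ring) (E₄.mul A), mcast (by ring) (E₄.mul B), ?_⟩
  ext τ
  simp only [Pi.add_apply, Pi.mul_apply, ModularForm.coe_mcast,
    show E₄.mul B τ = E₄ τ * B τ from rfl, show E₄.mul A τ = E₄ τ * A τ from rfl]
  ring

/-! ### The vanishing bound through a Wronskian. -/

lemma PowerSeries.coeff_X_mul_derivative (f : PowerSeries ℂ) (n : ℕ) :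
    (X * derivative ℂ f).coeff n = n * f.coeff n := by
  rcases n with _ | n
  · simp
  · rw [coeff_succ_X_mul, coeff_derivative]
    push_cast
    ring

/-- If f ≠ 0, dividing by f² gives D(B/f) = −c for a Laurent series B/f, but a series of the form
D(·) has no constant term. The proof clears denominators by f = X^N g and B = gC, with g a unit. -/
lemma PowerSeries.eq_zero_of_wronskian_add_sq_eq_zero {f B : PowerSeries ℂ} {c : ℂ} (hc : c ≠ 0)
    (h : f * (X * derivative ℂ B) - B * (X * derivative ℂ f) + c • f ^ 2 = 0) : f = 0 := by
  by_contra hf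
  obtain ⟨g, hg⟩ := X_pow_order_dvd (φ := f)
  set N := f.order.toNat
  have hg0 : constantCoeff g ≠ 0 := by
    have h1 := coeff_order hf
    rw [show f.order.toNat = N from rfl, hg] at h1
    simpa [coeff_X_pow_mul'] using h1
  obtain ⟨C, hC⟩ : ∃ C, B = g * C :=
    ⟨g⁻¹ * B, by rw [← mul_assoc, PowerSeries.mul_inv_cancel g hg0, one_mul]⟩
  have hg1 : g ≠ 0 := by
    rintro rfl
    simp at hg0
  have hX : derivative ℂ (X ^ N : PowerSeries ℂ) * X = (N : PowerSeries ℂ) * X ^ N := by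
    rcases Nat.eq_zero_or_pos N with h0 | h0
    · simp [h0]
    · obtain ⟨m, hm⟩ := Nat.exists_eq_succ_of_ne_zero h0.ne'
      simp [hm, derivative_X]
      ring
  have h2 : (X ^ N * g ^ 2) * (X * derivative ℂ C - (N : PowerSeries ℂ) * C + c • X ^ N) = 0 := by
    rw [hg, hC] at h
    simp only [Derivation.leibniz, smul_eq_mul, smul_eq_C_mul] at h ⊢
    linear_combination h + g ^ 2 * C * hX
  have h3 := (mul_eq_zero.mp h2).resolve_left
    (mul_ne_zero (pow_ne_zero _ X_ne_zero) (pow_ne_zero _ hg1))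
  -- In degree N the terms of DC − NC cancel, leaving c = 0.
  have h4 := congr_arg (coeff N) h3
  have h5 := coeff_X_mul_derivative C N
  have h6 : coeff N ((N : PowerSeries ℂ) * C) = N * coeff N C := by
    rw [← map_natCast (PowerSeries.C : ℂ →+* PowerSeries ℂ), coeff_C_mul]
  simp only [map_add, map_sub, h5, h6, coeff_smul, coeff_X_pow_self, map_zero] at h4
  exact hc (by simpa using h4)

/-- A quasimodular form of weight `w` and depth at most one whose `q`-expansion vanishes to order
greater than `w / 6` is zero. -/
theorem eq_zero_of_mem_quasimodularForms {w : ℕ} {f : ℍ → ℂ} (hf : f ∈ quasimodularForms w 1)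
    (h : ∀ i ≤ w / 6, (qExpansion 1 f).coeff i = 0) : f = 0 := by
  have hfc := IsHolomorphicAtCusp.of_mem_quasimodularForms hf
  obtain ⟨A, B, hAB⟩ := mem_quasimodularForms_one.mp hf
  have hB := IsHolomorphicAtCusp.modularForm B
  -- This is f·DB − B·Df + f²/12 written without E₂: the f²/12 absorbs both the weight mismatch in
  -- the Serre derivatives and the E₂² coming from DE₂.
  let W : ModularForm 𝒮ℒ ((2 * w : ℕ) : ℤ) :=
    mcast (by push_cast; ring) (A.mul B.serre) - mcast (by push_cast; ring) (B.mul A.serre) +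
      (12⁻¹ : ℂ) • (mcast (by push_cast; ring) (A.mul A) +
        mcast (by push_cast; ring) (E₄.mul (B.mul B)))
  have hW : (W : ℍ → ℂ) = f * normalizedDerivOfComplex B - B * normalizedDerivOfComplex f +
      (12⁻¹ : ℂ) • (f * f) := by
    ext τ
    have h1 := congrFun (normalizedDerivOfComplex_add _ _ (ModularFormClass.holo A)
      (E2_mdifferentiable.mul hB.mdiff)) τ
    have h2 := congrFun (normalizedDerivOfComplex_mul _ _ E2_mdifferentiable hB.mdiff) τ
    simp only [Pi.add_apply, Pi.mul_apply] at h1 h2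
    have h3 : W τ = A τ * B.serre τ - B τ * A.serre τ +
      12⁻¹ * (A τ * A τ + E₄ τ * (B τ * B τ)) := rfl
    rw [h3, hAB]
    simp only [Pi.add_apply, Pi.sub_apply, Pi.mul_apply, Pi.smul_apply, smul_eq_mul, serre_apply,
      h1, h2, normalizedDeriv_E2]
    push_cast
    ring
  have hWq : qExpansion 1 W =
      qExpansion 1 f * (PowerSeries.X * PowerSeries.derivative ℂ (qExpansion 1 B)) -
      qExpansion 1 B * (PowerSeries.X * PowerSeries.derivative ℂ (qExpansion 1 f)) +
      (12⁻¹ : ℂ) • qExpansion 1 f ^ 2 := by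
    have h1 := hfc.mul hB.normalizedDeriv
    have h2 := hB.mul hfc.normalizedDeriv
    rw [hW, (h1.sub h2).qExpansion_add ((hfc.mul hfc).smul _), h1.qExpansion_sub h2,
      (hfc.mul hfc).qExpansion_smul, hfc.qExpansion_mul hB.normalizedDeriv,
      hB.qExpansion_mul hfc.normalizedDeriv, hfc.qExpansion_mul hfc,
      hfc.qExpansion_normalizedDeriv, hB.qExpansion_normalizedDeriv, sq]
  have hdvd : PowerSeries.X ^ (w / 6 + 1) ∣ qExpansion 1 f :=
    PowerSeries.X_pow_dvd_iff.mpr fun m hm => h m (by lia)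
  have hdvd' : PowerSeries.X ^ (w / 6 + 1) ∣
      PowerSeries.X * PowerSeries.derivative ℂ (qExpansion 1 f) := by
    refine PowerSeries.X_pow_dvd_iff.mpr fun m hm => ?_
    rcases m with _ | m
    · simp
    · rw [PowerSeries.coeff_succ_X_mul, PowerSeries.coeff_derivative, h _ (by lia), zero_mul]
  have hW0 : W = 0 := by
    have hWd : PowerSeries.X ^ (w / 6 + 1) ∣ qExpansion 1 W := by
      rw [hWq, PowerSeries.smul_eq_C_mul, sq]
      exact ((hdvd.mul_right _).sub (hdvd'.mul_left _)).add ((hdvd.mul_right _).mul_left _)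
    -- The weight is 2w, so the Sturm bound 2w/12 equals w/6, one less than the vanishing order.
    refine sturm_bound_levelOne_nat (lt_of_lt_of_le ?_
      (PowerSeries.nat_le_order _ _ (PowerSeries.X_pow_dvd_iff.mp hWd)))
    rw [show 2 * w / 12 = w / 6 by lia]
    exact_mod_cast Nat.lt_succ_self _
  refine hfc.qExpansion_eq_zero_iff.mp
    (PowerSeries.eq_zero_of_wronskian_add_sq_eq_zero (c := 12⁻¹) (by norm_num) (hWq.symm.trans ?_))
  rw [hW0]
  exact qExpansion_zero 1

/-! ### Dimension, existence and uniqueness of extremal forms. -/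

/-- Applying S to the relation changes it only through the anomaly of E₂, leaving a nowhere
vanishing factor times B. -/
lemma eq_zero_of_add_E2_mul_eq_zero {w : ℤ} {A : ModularForm 𝒮ℒ w} {B : ModularForm 𝒮ℒ (w - 2)}
    (h : (⇑A + EisensteinSeries.E2 * ⇑B : ℍ → ℂ) = 0) : A = 0 ∧ B = 0 := by
  have hB : B = 0 := by
    ext z
    have h1 := congrFun h z
    have h2 := congrFun h (ModularGroup.S • z)
    have hA := congrFun (A.slash_SL_eq ModularGroup.S) z
    have hB := congrFun (B.slash_SL_eq ModularGroup.S) z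
    have hE := congrFun (E2_slash ModularGroup.S) z
    have hd : denom ModularGroup.S z ≠ 0 := denom_ne_zero _ z
    simp only [SL_slash_apply, Pi.add_apply, Pi.smul_apply, smul_eq_mul, Pi.mul_apply,
      Pi.zero_apply] at h1 h2 hA hB hE
    have hw : denom ModularGroup.S z ^ (-w) =
        denom ModularGroup.S z ^ (-2 : ℤ) * denom ModularGroup.S z ^ (-(w - 2)) := by
      rw [← zpow_add₀ hd]
      congr 1
      ring
    have hS : ((ModularGroup.S 1 0 : ℤ) : ℂ) = 1 := by simp [ModularGroup.S]
    have h3 : (12 * (2 * Real.pi * Complex.I)⁻¹ * (1 / denom ModularGroup.S z)) * B z = 0 := by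
      rw [hS] at hE
      linear_combination -B z * hE - EisensteinSeries.E2 (ModularGroup.S • z) *
        denom ModularGroup.S z ^ (-2 : ℤ) * hB - EisensteinSeries.E2 (ModularGroup.S • z) *
        B (ModularGroup.S • z) * hw + denom ModularGroup.S z ^ (-w) * h2 - hA - h1
    have h4 : (12 * (2 * Real.pi * Complex.I)⁻¹ * (1 / denom ModularGroup.S z) : ℂ) ≠ 0 :=
      mul_ne_zero (mul_ne_zero (by norm_num) (inv_ne_zero Complex.two_pi_I_ne_zero))
        (one_div_ne_zero hd)
    simpa using (mul_eq_zero.mp h3).resolve_left h4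
  subst hB
  refine ⟨?_, rfl⟩
  ext z
  simpa using congrFun h z

/-- The linear map `(A, B) ↦ A + E₂ B`. -/
noncomputable def addE2Mul (w : ℤ) :
    ModularForm 𝒮ℒ w × ModularForm 𝒮ℒ (w - 2) →ₗ[ℂ] (ℍ → ℂ) where
  toFun p := ⇑p.1 + EisensteinSeries.E2 * ⇑p.2
  map_add' p r := by
    ext τ
    simp
    ring
  map_smul' c p := by
    ext τ
    simp
    ring

lemma finrank_levelOne {k : ℕ} (hk : Even k) :
    Module.finrank ℂ (ModularForm 𝒮ℒ k) = if k ≡ 2 [MOD 12] then k / 12 else k / 12 + 1 := by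
  refine Module.finrank_eq_of_rank_eq ?_
  rw [dimension_level_one k hk]

lemma range_addE2Mul (w : ℤ) : LinearMap.range (addE2Mul w) = quasimodularForms w 1 := by
  ext f
  rw [LinearMap.mem_range, mem_quasimodularForms_one, Prod.exists]
  exact exists_congr fun A => exists_congr fun B => eq_comm

lemma finrank_quasimodularForms {w : ℕ} (hw : Even w) :
    Module.finrank ℂ (quasimodularForms w 1) = w / 6 + 1 := by
  have hinj : Injective (addE2Mul w) := by
    rw [← LinearMap.ker_eq_bot, LinearMap.ker_eq_bot']
    intro p hp
    exact Prod.ext (eq_zero_of_add_E2_mul_eq_zero hp).1 (eq_zero_of_add_E2_mul_eq_zero hp).2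
  rw [← range_addE2Mul, LinearMap.finrank_range_of_inj hinj, Module.finrank_prod,
    finrank_levelOne hw]
  -- For w = 0 the second summand has weight −2 and vanishes; the natural number dimension formula
  -- covers it only for w ≥ 2.
  rcases Nat.lt_or_ge w 2 with h | h
  · obtain rfl : w = 0 := by grind
    rw [Module.finrank_eq_of_rank_eq (n := 0) (by
      rw [levelOne_neg_weight_rank_zero (by norm_num)]; simp)]
    simp [Nat.ModEq]
  · obtain ⟨v, rfl⟩ := Nat.exists_eq_add_of_le' h
    have hv : Even v := by grind
    have : Module.finrank ℂ (ModularForm 𝒮ℒ (((v + 2 : ℕ) : ℤ) - 2)) =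
        Module.finrank ℂ (ModularForm 𝒮ℒ (v : ℤ)) := by
      rw [show ((v + 2 : ℕ) : ℤ) - 2 = v by push_cast; ring]
    rw [this, finrank_levelOne hv]
    simp only [Nat.ModEq]
    obtain ⟨u, rfl⟩ := hv
    split_ifs <;> lia

/-- The first `w / 6 + 1` coefficients of the `q`-expansion. -/
noncomputable def qExpansionCoeffs (w : ℕ) :
    quasimodularForms w 1 →ₗ[ℂ] (Fin (w / 6 + 1) → ℂ) where
  toFun f i := (qExpansion 1 (f : ℍ → ℂ)).coeff i
  map_add' f g := by
    ext i
    have h := (IsHolomorphicAtCusp.of_mem_quasimodularForms f.2).qExpansion_add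
      (IsHolomorphicAtCusp.of_mem_quasimodularForms g.2)
    simp [h]
  map_smul' c f := by
    ext i
    have h := (IsHolomorphicAtCusp.of_mem_quasimodularForms f.2).qExpansion_smul c
    simp [h]

lemma qExpansionCoeffs_injective (w : ℕ) : Injective (qExpansionCoeffs w) := by
  rw [← LinearMap.ker_eq_bot, LinearMap.ker_eq_bot']
  intro f hf
  exact Subtype.ext (eq_zero_of_mem_quasimodularForms f.2 fun i hi =>
    congrFun hf ⟨i, by lia⟩)

lemma qExpansionCoeffs_surjective {w : ℕ} (hw : Even w) : Surjective (qExpansionCoeffs w) := by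
  have : FiniteDimensional ℂ (quasimodularForms w 1) :=
    Module.finite_of_finrank_pos (by rw [finrank_quasimodularForms hw]; lia)
  refine (LinearMap.injective_iff_surjective_of_finrank_eq_finrank ?_).mp
    (qExpansionCoeffs_injective w)
  rw [finrank_quasimodularForms hw, Module.finrank_fin_fun]

/-- `f` is a quasimodular form of weight `w` and depth at most one with `q`-expansion
`q ^ (w / 6) + O(q ^ (w / 6 + 1))`. -/
structure IsExtremalDepthLEOne (w : ℕ) (f : ℍ → ℂ) : Prop where
  mem : f ∈ quasimodularForms w 1
  coeff_eq_zero : ∀ i < w / 6, (qExpansion 1 f).coeff i = 0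
  coeff_eq_one : (qExpansion 1 f).coeff (w / 6) = 1

lemma exists_isExtremalDepthLEOne {w : ℕ} (hw : Even w) : ∃ f, IsExtremalDepthLEOne w f := by
  obtain ⟨f, hf⟩ := qExpansionCoeffs_surjective hw (Pi.single (Fin.last _) 1)
  refine ⟨f, f.2, fun i hi => ?_, ?_⟩
  · have h := congrFun hf ⟨i, by lia⟩
    rwa [Pi.single_eq_of_ne (by simp [Fin.ext_iff]; lia)] at h
  · have h := congrFun hf (Fin.last _)
    rwa [Pi.single_eq_same] at h

lemma IsExtremalDepthLEOne.unique {w : ℕ} {f g : ℍ → ℂ} (hf : IsExtremalDepthLEOne w f)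
    (hg : IsExtremalDepthLEOne w g) : f = g := by
  have h : (⟨f, hf.mem⟩ : quasimodularForms w 1) = ⟨g, hg.mem⟩ := by
    refine qExpansionCoeffs_injective w (funext fun i => ?_)
    change (qExpansion 1 f).coeff i = (qExpansion 1 g).coeff i
    rcases lt_or_eq_of_le (Nat.lt_succ_iff.mp i.2) with h | h
    · rw [hf.coeff_eq_zero _ h, hg.coeff_eq_zero _ h]
    · rw [h, hf.coeff_eq_one, hg.coeff_eq_one]
  exact congrArg Subtype.val h

/-- Exact depth one is automatic: a modular form of weight w > 0 vanishing to order w/6 is zero by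
the Sturm bound when w/12 < w/6. Among positive even weights this inequality fails only for w = 2,
where M₂ = 0, and for the excluded w = 4. -/
lemma isNormalizedExtremal_iff {w : ℕ} (hw : Even w) (h0 : w ≠ 0) (h4 : w ≠ 4) (f : ℍ → ℂ) :
    IsNormalizedExtremal w 1 f ↔ IsExtremalDepthLEOne w f := by
  have hr := finrank_quasimodularForms hw
  constructor
  · rintro ⟨h1, -, h2, h3⟩
    rw [hr] at h2 h3
    refine ⟨h1, fun i hi => PowerSeries.coeff_of_lt_order _ ?_, h3⟩
    have : (qExpansion 1 f).order = (w / 6 : ℕ) :=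
      ENat.add_left_injective_of_ne_top ENat.one_ne_top (by simpa using h2)

    rw [this]
    exact_mod_cast hi
  · rintro ⟨h1, h2, h3⟩
    refine ⟨h1, fun h => ?_, ?_, by rw [hr]; exact h3⟩
    · obtain ⟨A, rfl⟩ := exists_of_mem_quasimodularForms_zero h
      have hA : A = 0 := by
        by_cases hw2 : w = 2
        · subst hw2
          exact rank_zero_iff_forall_zero.mp levelOne_weight_two_rank_zero A
        · refine sturm_bound_levelOne_nat (lt_of_lt_of_le ?_ (PowerSeries.nat_le_order _ _ h2))
          have : w / 12 < w / 6 := by grind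
          exact_mod_cast this
      rw [hA, FunLike.coe_zero, qExpansion_zero] at h3
      simp at h3
    · rw [hr, PowerSeries.order_eq_nat.mpr ⟨by rw [h3]; exact one_ne_zero, h2⟩]
      push_cast
      rfl

/-! ### Differential relations between extremal forms. -/

lemma PowerSeries.coeff_mul_of_coeff_eq_zero {f : PowerSeries ℂ} {n : ℕ} (E : PowerSeries ℂ)
    (hf : ∀ i < n, f.coeff i = 0) :
    (E * f).coeff n = E.coeff 0 * f.coeff n ∧ ∀ i < n, (E * f).coeff i = 0 := by
  obtain ⟨g, rfl⟩ := X_pow_dvd_iff.mpr hf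
  have h : E * (X ^ n * g) = X ^ n * (E * g) := by ring
  refine ⟨?_, fun i hi => ?_⟩
  · rw [h]
    simp [coeff_X_pow_mul']
  · rw [h, coeff_X_pow_mul', if_neg (by lia)]

lemma IsHolomorphicAtCusp.coeff_serreDerivative {f : ℍ → ℂ} {n : ℕ} (k : ℂ)
    (hf : IsHolomorphicAtCusp f) (h : ∀ i < n, (qExpansion 1 f).coeff i = 0) :
    (qExpansion 1 (Derivative.serreDerivative k f)).coeff n =
      (n - k / 12) * (qExpansion 1 f).coeff n ∧
    ∀ i < n, (qExpansion 1 (Derivative.serreDerivative k f)).coeff i = 0 := by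
  have hE := PowerSeries.coeff_mul_of_coeff_eq_zero (qExpansion 1 EisensteinSeries.E2) h
  rw [hf.qExpansion_serreDerivative]
  simp only [map_sub, PowerSeries.coeff_smul, smul_eq_mul,
    PowerSeries.coeff_X_mul_derivative]
  refine ⟨?_, fun i hi => ?_⟩
  · rw [hE.1, qExpansion_E2_coeff_zero]
    ring
  · rw [hE.2 i hi, h i hi]
    ring

lemma IsHolomorphicAtCusp.coeff_E₄_mul {f : ℍ → ℂ} {n : ℕ}
    (hf : IsHolomorphicAtCusp f) (h : ∀ i < n, (qExpansion 1 f).coeff i = 0) :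
    (qExpansion 1 (⇑E₄ * f)).coeff n = (qExpansion 1 f).coeff n ∧
    ∀ i < n, (qExpansion 1 (⇑E₄ * f)).coeff i = 0 := by
  rw [(modularForm E₄).qExpansion_mul hf]
  have h1 := PowerSeries.coeff_mul_of_coeff_eq_zero (qExpansion 1 E₄) h
  rwa [E_qExpansion_coeff_zero _ ⟨2, rfl⟩, one_mul] at h1

namespace IsExtremalDepthLEOne

lemma holomorphic {w : ℕ} {f : ℍ → ℂ} (hf : IsExtremalDepthLEOne w f) : IsHolomorphicAtCusp f :=
  .of_mem_quasimodularForms hf.mem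

lemma one : IsExtremalDepthLEOne 0 1 := by
  refine ⟨mem_quasimodularForms_one.mpr ⟨mcast (by simp) (1 : ModularForm 𝒮ℒ 0), 0, ?_⟩,
    by simp, ?_⟩
  · ext τ
    simp
  · rw [qExpansion_one]
    simp

lemma E₄_mul {n : ℕ} {f : ℍ → ℂ} (hf : IsExtremalDepthLEOne (6 * n) f) :
    IsExtremalDepthLEOne (6 * n + 4) (⇑E₄ * f) := by
  have h6 : 6 * n / 6 = n := by lia
  have h0 := hf.coeff_eq_zero
  have h1 := hf.coeff_eq_one
  rw [h6] at h0 h1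
  have h := hf.holomorphic.coeff_E₄_mul h0
  have h6' : (6 * n + 4) / 6 = n := by lia
  exact ⟨by exact_mod_cast E₄_mul_mem_quasimodularForms hf.mem, by rw [h6']; exact h.2,
    by rw [h6', h.1, h1]⟩

lemma serreDerivative_smul_mem {n : ℕ} {f : ℍ → ℂ} (hf : IsExtremalDepthLEOne (6 * n) f) :
    serreDerivative (6 * n - 1) f ∈ quasimodularForms ((6 * n + 2 : ℕ) : ℤ) 1 := by
  have h := serreDerivative_mem_quasimodularForms hf.mem
  push_cast at h ⊢
  exact h

/-- The leading exponent n stays, and the leading coefficient becomes n − (6n−1)/12 = (6n+1)/12,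
which is never 0. Since (6n+2)/6 = n, only a rescaling is needed. -/
lemma serreDerivative_smul {n : ℕ} {f : ℍ → ℂ} (hf : IsExtremalDepthLEOne (6 * n) f) :
    IsExtremalDepthLEOne (6 * n + 2)
      ((12 / (6 * n + 1) : ℂ) • serreDerivative (6 * n - 1) f) := by
  have h6 : 6 * n / 6 = n := by lia
  have h6' : (6 * n + 2) / 6 = n := by lia
  have h0 := hf.coeff_eq_zero
  have h1 := hf.coeff_eq_one
  rw [h6] at h0 h1
  have h := hf.holomorphic.coeff_serreDerivative (6 * n - 1) h0
  have hs := (hf.holomorphic.serreDerivative (6 * n - 1)).qExpansion_smul (12 / (6 * n + 1) : ℂ)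
  refine ⟨Submodule.smul_mem _ _ hf.serreDerivative_smul_mem, ?_, ?_⟩
  · intro i hi
    rw [h6'] at hi
    rw [hs, PowerSeries.coeff_smul, h.2 i hi, smul_zero]
  · rw [h6', hs, PowerSeries.coeff_smul, h.1, h1, smul_eq_mul]
    have : (6 * n + 1 : ℂ) ≠ 0 := by exact_mod_cast Nat.succ_ne_zero (6 * n)
    field_simp
    ring

/-- The Kaneko–Zagier equation. -/
lemma serreDerivative_serreDerivative {n : ℕ} {f : ℍ → ℂ} (hf : IsExtremalDepthLEOne (6 * n) f) :
    serreDerivative (6 * n + 1) (serreDerivative (6 * n - 1) f) =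
      ((36 * n ^ 2 - 1) / 144 : ℂ) • (⇑E₄ * f) := by
  have h6 : 6 * n / 6 = n := by lia
  have h0 := hf.coeff_eq_zero
  have h1 := hf.coeff_eq_one
  rw [h6] at h0 h1
  have hE := hf.holomorphic.coeff_E₄_mul h0
  have hd := hf.holomorphic.coeff_serreDerivative (6 * n - 1) h0
  have hc := hf.holomorphic.serreDerivative (6 * n - 1)
  have hdd := hc.coeff_serreDerivative (6 * n + 1) hd.2
  have hEc := (IsHolomorphicAtCusp.modularForm E₄).mul hf.holomorphic
  have hq := (hc.serreDerivative (6 * n + 1)).qExpansion_sub (hEc.smul ((36 * n ^ 2 - 1) / 144))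
  rw [hEc.qExpansion_smul] at hq
  have hm1 := serreDerivative_mem_quasimodularForms hf.serreDerivative_smul_mem
  have hm2 := E₄_mul_mem_quasimodularForms hf.mem
  have e1 : (((6 * n + 2 : ℕ) : ℤ) : ℂ) - 1 = 6 * n + 1 := by push_cast; ring
  have e2 : ((6 * n + 2 : ℕ) : ℤ) + 2 = ((6 * n + 4 : ℕ) : ℤ) := by push_cast; ring
  have e3 : ((6 * n : ℕ) : ℤ) + 4 = ((6 * n + 4 : ℕ) : ℤ) := by push_cast; ring
  rw [e1, e2] at hm1
  rw [e3] at hm2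
  -- The difference has weight 6n+4, whose vanishing bound is still n. Its coefficient of qⁿ is zero
  -- because (n − (6n+1)/12)(n − (6n−1)/12) = (36n²−1)/144.
  refine sub_eq_zero.mp (eq_zero_of_mem_quasimodularForms
    (Submodule.sub_mem _ hm1 (Submodule.smul_mem _ _ hm2)) fun i hi => ?_)
  rw [hq, map_sub, PowerSeries.coeff_smul, smul_eq_mul]
  rcases lt_or_eq_of_le (show i ≤ n by lia) with h | rfl
  · rw [hdd.2 i h, hE.2 i h]
    ring
  · rw [hdd.1, hd.1, hE.1, h1]
    ring

end IsExtremalDepthLEOne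

/-! ### Gauss's hypergeometric equation. -/

lemma taylorAtZero_sub {f g : ℂ → ℂ} (hf : AnalyticAt ℂ f 0) (hg : AnalyticAt ℂ g 0) :
    taylorAtZero (f - g) = taylorAtZero f - taylorAtZero g := by
  ext
  simp [taylorAtZero, iteratedDeriv_sub hf.contDiffAt hg.contDiffAt, mul_sub]

lemma taylorAtZero_pow {f : ℂ → ℂ} (hf : AnalyticAt ℂ f 0) (n : ℕ) :
    taylorAtZero (f ^ n) = taylorAtZero f ^ n := by
  induction n with
  | zero =>
    rw [pow_zero, pow_zero]
    ext m
    rcases m with _ | m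
    · simp [taylorAtZero]
    · have : iteratedDeriv (m + 1) (1 : ℂ → ℂ) 0 = 0 := by
        simpa using! iteratedDeriv_const (n := m + 1) (c := (1 : ℂ)) (x := (0 : ℂ))
      simp [taylorAtZero, PowerSeries.coeff_one, this]
  | succ n ih => rw [pow_succ, taylorAtZero_mul (hf.pow n) hf, ih, pow_succ]

lemma coeff_one_taylorAtZero (f : ℂ → ℂ) : (taylorAtZero f).coeff 1 = deriv f 0 := by
  simp [taylorAtZero]

section Hypergeometric

variable {a b c : ℂ}

/-- Excluding nonpositive integers for a and b prevents termination, so the radius is exactly 1;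
excluding them for c keeps the denominators nonzero. -/
lemma hasFPowerSeriesOnBall_ordinaryHypergeometric (habc : ∀ k : ℕ, ↑k ≠ -a ∧ ↑k ≠ -b ∧ ↑k ≠ -c) :
    HasFPowerSeriesOnBall (₂F₁ a b c : ℂ → ℂ)
      (.ofScalars ℂ (ordinaryHypergeometricCoefficient a b c)) 0 1 := by
  have hr := ordinaryHypergeometricSeries_radius_eq_one ℂ a b c habc
  have h := (ordinaryHypergeometricSeries ℂ a b c).hasFPowerSeriesOnBall (by rw [hr]; exact one_pos)
  rwa [hr] at h

lemma differentiableOn_ordinaryHypergeometric (habc : ∀ k : ℕ, ↑k ≠ -a ∧ ↑k ≠ -b ∧ ↑k ≠ -c) :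
    DifferentiableOn ℂ (₂F₁ a b c : ℂ → ℂ) (Metric.ball 0 1) := by
  have h := (hasFPowerSeriesOnBall_ordinaryHypergeometric habc).differentiableOn
  rwa [← ENNReal.ofReal_one, Metric.eball_ofReal] at h

/-- Gauss's hypergeometric differential equation. -/
theorem ordinaryHypergeometric_differential_equation
    (habc : ∀ k : ℕ, ↑k ≠ -a ∧ ↑k ≠ -b ∧ ↑k ≠ -c) {x : ℂ} (hx : ‖x‖ < 1) :
    x * (1 - x) * deriv (deriv (₂F₁ a b c)) x + (c - (a + b + 1) * x) * deriv (₂F₁ a b c) x -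
      a * b * ₂F₁ a b c x = 0 := by
  set Φ : ℂ → ℂ := ₂F₁ a b c with hΦ
  have hd : DifferentiableOn ℂ Φ (Metric.ball 0 1) := differentiableOn_ordinaryHypergeometric habc
  have hd1 : DifferentiableOn ℂ (deriv Φ) (Metric.ball 0 1) := hd.deriv Metric.isOpen_ball
  have hd2 : DifferentiableOn ℂ (deriv (deriv Φ)) (Metric.ball 0 1) := hd1.deriv Metric.isOpen_ball
  have hmem : (0 : ℂ) ∈ Metric.ball (0 : ℂ) 1 := by simp
  have ha := hd.analyticAt (Metric.isOpen_ball.mem_nhds hmem)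
  have ha1 := hd1.analyticAt (Metric.isOpen_ball.mem_nhds hmem)
  have ha2 := hd2.analyticAt (Metric.isOpen_ball.mem_nhds hmem)
  have hid : AnalyticAt ℂ (fun z : ℂ => z) 0 := analyticAt_id
  let R : ℂ → ℂ := (fun z => z) * deriv (deriv Φ) - (fun z => z) * ((fun z => z) * deriv (deriv Φ)) +
    (fun z => c * deriv Φ z) - (fun z => (a + b + 1) * ((fun z : ℂ => z) * deriv Φ) z) -
    fun z => a * b * Φ z
  have hT : taylorAtZero Φ = .mk (ordinaryHypergeometricCoefficient a b c) :=
    taylorAtZero_of_hasFPowerSeriesAt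
      (hasFPowerSeriesOnBall_ordinaryHypergeometric habc).hasFPowerSeriesAt
  have hR : taylorAtZero R = 0 := by
    have b1 := hid.mul ha2
    have b2 := hid.mul b1
    have b3 : AnalyticAt ℂ (fun z => c * deriv Φ z) 0 := analyticAt_const.mul ha1
    have b4 : AnalyticAt ℂ (fun z => (a + b + 1) * ((fun z : ℂ => z) * deriv Φ) z) 0 :=
      analyticAt_const.mul (hid.mul ha1)
    have b5 : AnalyticAt ℂ (fun z => a * b * Φ z) 0 := analyticAt_const.mul ha
    rw [taylorAtZero_sub (((b1.sub b2).add b3).sub b4) b5,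
      taylorAtZero_sub ((b1.sub b2).add b3) b4, taylorAtZero_add (b1.sub b2) b3,
      taylorAtZero_sub b1 b2, taylorAtZero_mul hid b1, taylorAtZero_mul hid ha2,
      taylorAtZero_const_mul, taylorAtZero_const_mul, taylorAtZero_const_mul,
      taylorAtZero_mul hid ha1, taylorAtZero_id, taylorAtZero_deriv, taylorAtZero_deriv, hT]
    ext m
    -- The two-term recursion of the coefficients, to which the differential equation reduces degree
    -- by degree.
    have hc (k : ℕ) : ((k : ℂ) + 1) * (k + c) * ordinaryHypergeometricCoefficient a b c (k + 1) =
        (k + a) * (k + b) * ordinaryHypergeometricCoefficient a b c k := by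
      have h1 : (k : ℂ) + 1 ≠ 0 := by exact_mod_cast k.succ_ne_zero
      have h2 : (k : ℂ) + c ≠ 0 := fun h => (habc k).2.2 (by linear_combination h)
      have h3 : (k.factorial : ℂ) ≠ 0 := by exact_mod_cast k.factorial_ne_zero
      have h4 : (ascPochhammer ℂ k).eval c ≠ 0 := by
        rw [Ne, ascPochhammer_eval_eq_zero_iff]
        rintro ⟨j, -, hj⟩
        exact (habc j).2.2 hj
      simp only [ordinaryHypergeometricCoefficient, ascPochhammer_succ_eval, Nat.factorial_succ]
      have h2' : c + (k : ℂ) ≠ 0 := by rwa [add_comm]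
      push_cast
      field_simp
      ring
    rcases m with _ | _ | m
    · have := hc 0
      simp [PowerSeries.coeff_derivative, -PowerSeries.coeff_zero_eq_constantCoeff,
        PowerSeries.coeff_zero_X_mul] at this ⊢
      linear_combination this
    · have := hc 1
      simp [PowerSeries.coeff_derivative, PowerSeries.coeff_succ_X_mul] at this ⊢
      linear_combination this
    · have := hc (m + 2)
      simp [PowerSeries.coeff_derivative, PowerSeries.coeff_succ_X_mul] at this ⊢
      linear_combination this
  have hRd : DifferentiableOn ℂ R (Metric.ball 0 1) := by
    have h1 : DifferentiableOn ℂ (fun z : ℂ => z) (Metric.ball 0 1) := differentiableOn_id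
    exact ((((h1.mul hd2).sub (h1.mul (h1.mul hd2))).add (hd1.const_mul c)).sub
      ((h1.mul hd1).const_mul (a + b + 1))).sub (hd.const_mul (a * b))
  -- The identity theorem carries the equation from a neighbourhood of 0 to the whole unit disc.
  have hz := (hRd.analyticOnNhd Metric.isOpen_ball).eqOn_zero_of_preconnected_of_eventuallyEq_zero
    (convex_ball _ _).isPreconnected hmem (eventuallyEq_zero_of_taylorAtZero_eq_zero
      (hRd.analyticAt (Metric.isOpen_ball.mem_nhds hmem)) hR)
      (show x ∈ Metric.ball 0 1 by simpa using hx)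
  simp only [R, Pi.sub_apply, Pi.add_apply, Pi.mul_apply, Pi.zero_apply] at hz
  linear_combination hz

end Hypergeometric

/-! ### Uniqueness for systems with a regular singularity. -/

/-- A solution of a linear first order system with regular singularity that vanishes to high order
is zero. -/
lemma PowerSeries.eq_zero_of_system {y z p₁ p₂ p₃ p₄ : PowerSeries ℂ} {n : ℕ}
    (h₁ : X * derivative ℂ y = p₁ * y + p₂ * z) (h₂ : X * derivative ℂ z = p₃ * y + p₄ * z)
    (hp : p₂.coeff 0 ≠ 0) (hy : ∀ i ≤ n, y.coeff i = 0)
    (hdet : ∀ k : ℕ, n < k →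
      ((k : ℂ) - p₁.coeff 0) * (k - p₄.coeff 0) ≠ p₂.coeff 0 * p₃.coeff 0) : y = 0 := by
  suffices h : ∀ k, y.coeff k = 0 ∧ z.coeff k = 0 by
    ext k
    simpa using (h k).1
  intro k
  induction k using Nat.strong_induction_on with | _ k ih =>
  have hy' := fun i hi => (ih i hi).1
  have hz' := fun i hi => (ih i hi).2
  have e₁ := congr_arg (coeff k) h₁
  have e₂ := congr_arg (coeff k) h₂
  rw [coeff_X_mul_derivative, map_add, (coeff_mul_of_coeff_eq_zero _ hy').1,
    (coeff_mul_of_coeff_eq_zero _ hz').1] at e₁ e₂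
  -- Through degree n the vanishing of y is given and p₂(0) ≠ 0 passes it on to z. Beyond n,
  -- eliminating z multiplies the coefficient of y by the indicial determinant.
  rcases le_or_gt k n with hk | hk
  · have hyk := hy k hk
    refine ⟨hyk, ?_⟩
    rw [hyk, mul_zero, mul_zero, zero_add] at e₁
    exact (mul_eq_zero.mp e₁.symm).resolve_left hp
  · have hyk : y.coeff k = 0 := by
      have h : (((k : ℂ) - p₁.coeff 0) * (k - p₄.coeff 0) - p₂.coeff 0 * p₃.coeff 0) *
          y.coeff k = 0 := by
        linear_combination (k - p₄.coeff 0) * e₁ + p₂.coeff 0 * e₂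
      exact (mul_eq_zero.mp h).resolve_left (sub_ne_zero.mpr (hdet k hk))
    refine ⟨hyk, ?_⟩
    rw [hyk, mul_zero, mul_zero, zero_add] at e₁
    exact (mul_eq_zero.mp e₁.symm).resolve_left hp

/-- The analytic form of `PowerSeries.eq_zero_of_system`. -/
lemma eventuallyEq_zero_of_system {y z p₁ p₂ p₃ p₄ : ℂ → ℂ} {n : ℕ}
    (ay : AnalyticAt ℂ y 0) (az : AnalyticAt ℂ z 0) (a₁ : AnalyticAt ℂ p₁ 0)
    (a₂ : AnalyticAt ℂ p₂ 0) (a₃ : AnalyticAt ℂ p₃ 0) (a₄ : AnalyticAt ℂ p₄ 0)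
    (h₁ : ∀ᶠ q in 𝓝[≠] 0, q * deriv y q = p₁ q * y q + p₂ q * z q)
    (h₂ : ∀ᶠ q in 𝓝[≠] 0, q * deriv z q = p₃ q * y q + p₄ q * z q)
    (hp : p₂ 0 ≠ 0) (hy : ∀ i ≤ n, (taylorAtZero y).coeff i = 0)
    (hdet : ∀ k : ℕ, n < k → ((k : ℂ) - p₁ 0) * (k - p₄ 0) ≠ p₂ 0 * p₃ 0) : y =ᶠ[𝓝 0] 0 := by
  have hid : AnalyticAt ℂ (fun z : ℂ => z) 0 := analyticAt_id
  have key {u r s : ℂ → ℂ} (au : AnalyticAt ℂ u 0) (ar : AnalyticAt ℂ r 0) (as : AnalyticAt ℂ s 0)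
      (h : ∀ᶠ q in 𝓝[≠] 0, q * deriv u q = r q * y q + s q * z q) :
      PowerSeries.X * PowerSeries.derivative ℂ (taylorAtZero u) =
        taylorAtZero r * taylorAtZero y + taylorAtZero s * taylorAtZero z := by
    -- Both sides are analytic at 0, so agreement on the punctured neighbourhood extends to 0.
    have h' : (fun z => z) * deriv u =ᶠ[𝓝 0] r * y + s * z :=
      ((hid.mul au.deriv).frequently_eq_iff_eventually_eq
        ((ar.mul ay).add (as.mul az))).mp h.frequently
    rw [← taylorAtZero_id, ← taylorAtZero_deriv, ← taylorAtZero_mul hid au.deriv,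
      taylorAtZero_congr h', taylorAtZero_add (ar.mul ay) (as.mul az), taylorAtZero_mul ar ay,
      taylorAtZero_mul as az]
  refine eventuallyEq_zero_of_taylorAtZero_eq_zero ay
    (PowerSeries.eq_zero_of_system (key ay a₁ a₂ h₁) (key az a₃ a₄ h₂) ?_ hy ?_)
  · rwa [coeff_zero_taylorAtZero]
  · simpa only [coeff_zero_taylorAtZero] using hdet

/-! ### Logarithmic derivatives of E₄, E₆, 1/j and the fourth root of E₄. -/

/-- `f` is differentiable at `q` with `q * f' q = d`. -/
def HasThetaDerivAt (f : ℂ → ℂ) (d q : ℂ) : Prop := ∃ f', HasDerivAt f f' q ∧ q * f' = d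

namespace HasThetaDerivAt

variable {f g : ℂ → ℂ} {d e q : ℂ}

lemma mul (hf : HasThetaDerivAt f d q) (hg : HasThetaDerivAt g e q) :
    HasThetaDerivAt (fun z => f z * g z) (d * g q + f q * e) q := by
  obtain ⟨f', hf, rfl⟩ := hf
  obtain ⟨g', hg, rfl⟩ := hg
  exact ⟨_, hf.mul hg, by ring⟩

lemma div (hf : HasThetaDerivAt f d q) (hg : HasThetaDerivAt g e q) (h : g q ≠ 0) :
    HasThetaDerivAt (fun z => f z / g z) ((d * g q - f q * e) / g q ^ 2) q := by
  obtain ⟨f', hf, rfl⟩ := hf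
  obtain ⟨g', hg, rfl⟩ := hg
  exact ⟨_, hf.div hg h, by ring⟩

lemma comp {F : ℂ → ℂ} {F' : ℂ} (hF : HasDerivAt F F' (f q)) (hf : HasThetaDerivAt f d q) :
    HasThetaDerivAt (fun z => F (f z)) (F' * d) q := by
  obtain ⟨f', hf, rfl⟩ := hf
  exact ⟨_, hF.comp q hf, by ring⟩

lemma congr_deriv (hf : HasThetaDerivAt f d q) (h : d = e) : HasThetaDerivAt f e q := h ▸ hf

lemma const_mul (c : ℂ) (hf : HasThetaDerivAt f d q) :
    HasThetaDerivAt (fun z => c * f z) (c * d) q := by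
  obtain ⟨f', hf, rfl⟩ := hf
  exact ⟨_, hf.const_mul c, by ring⟩

lemma deriv_eq (hf : HasThetaDerivAt f d q) : q * deriv f q = d := by
  obtain ⟨f', hf, rfl⟩ := hf
  rw [hf.deriv]

end HasThetaDerivAt

lemma IsHolomorphicAtCusp.hasThetaDerivAt {f : ℍ → ℂ} (hf : IsHolomorphicAtCusp f) (τ : ℍ) :
    HasThetaDerivAt (cuspFunction 1 f) (normalizedDerivOfComplex f τ) (Periodic.qParam 1 τ) := by
  have hq : ‖Periodic.qParam 1 (τ : ℂ)‖ < 1 := Periodic.norm_qParam_lt_one one_pos τ.im_pos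
  exact ⟨_, (hf.differentiableOn.differentiableAt
    (Metric.isOpen_ball.mem_nhds (by simpa using hq))).hasDerivAt, (hf.normalizedDeriv_eq τ).symm⟩

lemma exists_qParam_eq {q : ℂ} (h0 : q ≠ 0) (h1 : ‖q‖ < 1) :
    ∃ τ : ℍ, Periodic.qParam 1 (τ : ℂ) = q :=
  ⟨⟨_, Periodic.im_invQParam_pos_of_norm_lt_one one_pos h1 h0⟩,
    Periodic.qParam_right_inv one_ne_zero h0⟩

local notation "e₂" => cuspFunction 1 EisensteinSeries.E2
local notation "e₄" => cuspFunction 1 (E₄ : ℍ → ℂ)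
local notation "e₆" => cuspFunction 1 (E₆ : ℍ → ℂ)

lemma hasThetaDerivAt_cuspFunction_E₄ {q : ℂ} (h0 : q ≠ 0) (h1 : ‖q‖ < 1) :
    HasThetaDerivAt e₄ ((e₂ q * e₄ q - e₆ q) / 3) q := by
  obtain ⟨τ, rfl⟩ := exists_qParam_eq h0 h1
  refine ((IsHolomorphicAtCusp.modularForm E₄).hasThetaDerivAt τ).congr_deriv ?_
  rw [(IsHolomorphicAtCusp.modularForm E₄).cuspFunction_qParam,
    (IsHolomorphicAtCusp.modularForm E₆).cuspFunction_qParam,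
    IsHolomorphicAtCusp.E2.cuspFunction_qParam]
  have := serre_E₄_apply τ
  rw [serre_apply] at this
  push_cast at this
  linear_combination this

lemma hasThetaDerivAt_cuspFunction_E₆ {q : ℂ} (h0 : q ≠ 0) (h1 : ‖q‖ < 1) :
    HasThetaDerivAt e₆ ((e₂ q * e₆ q - e₄ q ^ 2) / 2) q := by
  obtain ⟨τ, rfl⟩ := exists_qParam_eq h0 h1
  refine ((IsHolomorphicAtCusp.modularForm E₆).hasThetaDerivAt τ).congr_deriv ?_
  rw [(IsHolomorphicAtCusp.modularForm E₄).cuspFunction_qParam,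
    (IsHolomorphicAtCusp.modularForm E₆).cuspFunction_qParam,
    IsHolomorphicAtCusp.E2.cuspFunction_qParam]
  have := serre_E₆_apply τ
  rw [serre_apply] at this
  push_cast at this
  linear_combination this

lemma cuspFunction_E2_zero : e₂ 0 = 1 := by
  rw [← coeff_zero_taylorAtZero (cuspFunction 1 _), ← qExpansion_eq_taylorAtZero,
    qExpansion_E2_coeff_zero]

lemma cuspFunction_E₄_zero : e₄ 0 = 1 := by
  rw [← coeff_zero_taylorAtZero (cuspFunction 1 _), ← qExpansion_eq_taylorAtZero,
    E_qExpansion_coeff_zero _ ⟨2, rfl⟩]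

lemma cuspFunction_E₆_zero : e₆ 0 = 1 := by
  rw [← coeff_zero_taylorAtZero (cuspFunction 1 _), ← qExpansion_eq_taylorAtZero,
    E_qExpansion_coeff_zero _ ⟨3, rfl⟩]

/-- The reciprocal of the elliptic modular function in terms of `q`. -/
noncomputable def jInv (q : ℂ) : ℂ := (1 - e₆ q ^ 2 / e₄ q ^ 3) / 1728

lemma jInv_zero : jInv 0 = 0 := by
  simp [jInv, cuspFunction_E₄_zero, cuspFunction_E₆_zero]

lemma jInv_qParam {τ : ℍ} (h : E₄ τ ≠ 0) :
    jInv (Periodic.qParam 1 (τ : ℂ)) = 1 / jInvariant τ := by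
  rw [jInv, jInvariant, (IsHolomorphicAtCusp.modularForm E₄).cuspFunction_qParam,
    (IsHolomorphicAtCusp.modularForm E₆).cuspFunction_qParam, discriminant_eq_E₄_cube_sub_E₆_sq]
  field_simp

lemma differentiableAt_jInv {q : ℂ} (h1 : ‖q‖ < 1) (h4 : e₄ q ≠ 0) : DifferentiableAt ℂ jInv q := by
  have hm : Metric.ball (0 : ℂ) 1 ∈ 𝓝 q := Metric.isOpen_ball.mem_nhds (by simpa using h1)
  have d4 := (IsHolomorphicAtCusp.modularForm E₄).differentiableOn.differentiableAt hm
  have d6 := (IsHolomorphicAtCusp.modularForm E₆).differentiableOn.differentiableAt hm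
  exact ((differentiableAt_const 1).sub ((d6.pow 2).div (d4.pow 3) (pow_ne_zero 3 h4))).div_const _

/-- From E₄ = 1 + 240q + … and E₆ = 1 − 504q + …: (3·240 + 2·504)/1728 = 1. -/
lemma deriv_jInv_zero : deriv jInv 0 = 1 := by
  have hm : Metric.ball (0 : ℂ) 1 ∈ 𝓝 (0 : ℂ) := Metric.ball_mem_nhds _ one_pos
  have d4 := ((IsHolomorphicAtCusp.modularForm E₄).differentiableOn.differentiableAt hm).hasDerivAt
  have d6 := ((IsHolomorphicAtCusp.modularForm E₆).differentiableOn.differentiableAt hm).hasDerivAt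
  rw [← coeff_one_taylorAtZero, ← qExpansion_eq_taylorAtZero, E₄_qExpansion_coeff_one] at d4
  rw [← coeff_one_taylorAtZero, ← qExpansion_eq_taylorAtZero, E₆_qExpansion_coeff_one] at d6
  have h := (((hasDerivAt_const (0 : ℂ) (1 : ℂ)).sub ((d6.pow 2).div (d4.pow 3)
    (by simp [cuspFunction_E₄_zero]))).div_const 1728)
  refine Eq.trans h.deriv ?_
  simp [cuspFunction_E₄_zero, cuspFunction_E₆_zero]
  norm_num

lemma hasThetaDerivAt_jInv {q : ℂ} (h0 : q ≠ 0) (h1 : ‖q‖ < 1) (h4 : e₄ q ≠ 0) :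
    HasThetaDerivAt jInv (jInv q * (e₆ q / e₄ q)) q := by
  have d4 := hasThetaDerivAt_cuspFunction_E₄ h0 h1
  have d6 := hasThetaDerivAt_cuspFunction_E₆ h0 h1
  have h := HasThetaDerivAt.comp (F := fun z => (1 - z) / 1728) (f := fun z => e₆ z ^ 2 / e₄ z ^ 3)
    (((hasDerivAt_id _).const_sub 1).div_const 1728)
    ((HasThetaDerivAt.comp (hasDerivAt_pow 2 _) d6).div
      (HasThetaDerivAt.comp (hasDerivAt_pow 3 _) d4) (pow_ne_zero 3 h4))
  refine h.congr_deriv ?_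
  rw [jInv]
  field_simp
  ring

/-- The holomorphic fourth root of `E₄` near the cusp. -/
noncomputable def fourthRootE₄ (q : ℂ) : ℂ := e₄ q ^ (1 / 4 : ℂ)

lemma hasThetaDerivAt_fourthRootE₄ {q : ℂ} (h0 : q ≠ 0) (h1 : ‖q‖ < 1)
    (h4 : e₄ q ∈ Complex.slitPlane) : HasThetaDerivAt fourthRootE₄
      (fourthRootE₄ q * ((e₂ q - e₆ q / e₄ q) / 12)) q := by
  have hne := Complex.slitPlane_ne_zero h4
  obtain ⟨f', hf, hf'⟩ := hasThetaDerivAt_cuspFunction_E₄ h0 h1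
  refine ⟨_, hf.cpow_const h4, ?_⟩
  rw [Complex.cpow_sub _ _ hne, Complex.cpow_one, fourthRootE₄]
  have : q * (1 / 4 * (e₄ q ^ (1 / 4 : ℂ) / e₄ q) * f') =
    1 / 4 * (e₄ q ^ (1 / 4 : ℂ) / e₄ q) * (q * f') := by ring
  rw [this, hf']
  field_simp
  ring

lemma fourthRootE₄_zero : fourthRootE₄ 0 = 1 := by
  rw [fourthRootE₄, cuspFunction_E₄_zero, Complex.one_cpow]

lemma fourthRootE₄_ne_zero {q : ℂ} (h4 : e₄ q ≠ 0) : fourthRootE₄ q ≠ 0 := by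
  simp [fourthRootE₄, h4]

/-! ### Hypergeometric candidates and the system they satisfy. -/

/-- The function `j⁻ⁿ E₄^{m/4} Φ(1728/j)` in terms of `q`. -/
noncomputable def hypergeometricCandidate (n : ℕ) (m : ℤ) (Φ : ℂ → ℂ) (q : ℂ) : ℂ :=
  jInv q ^ n * fourthRootE₄ q ^ m * Φ (1728 * jInv q)

lemma hasThetaDerivAt_hypergeometricCandidate (n : ℕ) (m : ℤ) {Φ : ℂ → ℂ} {Φ' q : ℂ} (h0 : q ≠ 0)
    (h1 : ‖q‖ < 1) (h4 : e₄ q ∈ Complex.slitPlane) (hΦ : HasDerivAt Φ Φ' (1728 * jInv q)) :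
    HasThetaDerivAt (hypergeometricCandidate n m Φ) (jInv q ^ n * fourthRootE₄ q ^ m *
      ((n * (e₆ q / e₄ q) + m / 12 * (e₂ q - e₆ q / e₄ q)) * Φ (1728 * jInv q) +
        e₆ q / e₄ q * (1728 * jInv q * Φ'))) q := by
  have hne := Complex.slitPlane_ne_zero h4
  have ht := hasThetaDerivAt_jInv h0 h1 hne
  have hu := hasThetaDerivAt_fourthRootE₄ h0 h1 h4
  have hu0 := fourthRootE₄_ne_zero hne
  have h := ((HasThetaDerivAt.comp (hasDerivAt_pow n _) ht).mul
    (HasThetaDerivAt.comp (hasDerivAt_zpow m _ (Or.inl hu0)) hu)).mul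
    (HasThetaDerivAt.comp hΦ (ht.const_mul 1728))
  refine h.congr_deriv ?_
  have hn : (n : ℂ) * jInv q ^ (n - 1) * jInv q = n * jInv q ^ n := by
    rcases n with _ | n
    · simp
    · rw [Nat.add_sub_cancel]
      ring
  have hm : fourthRootE₄ q ^ (m - 1) * fourthRootE₄ q = fourthRootE₄ q ^ m := by
    rw [← zpow_add_one₀ hu0, sub_add_cancel]
  linear_combination (e₆ q / e₄ q * fourthRootE₄ q ^ m * Φ (1728 * jInv q)) * hn +
    (jInv q ^ n * m * ((e₂ q - e₆ q / e₄ q) / 12) * Φ (1728 * jInv q)) * hm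

lemma HasThetaDerivAt.sub {f g : ℂ → ℂ} {d e q : ℂ} (hf : HasThetaDerivAt f d q)
    (hg : HasThetaDerivAt g e q) : HasThetaDerivAt (f - g) (d - e) q := by
  obtain ⟨f', hf, rfl⟩ := hf
  obtain ⟨g', hg, rfl⟩ := hg
  exact ⟨_, hf.sub hg, by ring⟩

/-- A radius such that on the disc of that radius `E₄` avoids the branch cut and `|1728 / j| < 1`. -/
structure IsSmallRadius (r : ℝ) : Prop where
  pos : 0 < r
  le_one : r ≤ 1
  slitPlane : ∀ q : ℂ, ‖q‖ < r → e₄ q ∈ Complex.slitPlane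
  norm_lt : ∀ q : ℂ, ‖q‖ < r → ‖1728 * jInv q‖ < 1

lemma exists_isSmallRadius : ∃ r, IsSmallRadius r := by
  have c4 := (IsHolomorphicAtCusp.modularForm E₄).analyticAt_zero.continuousAt
  have h4 : ∀ᶠ q in 𝓝 (0 : ℂ), e₄ q ∈ Complex.slitPlane :=
    c4.eventually_mem (Complex.isOpen_slitPlane.mem_nhds (by simp [cuspFunction_E₄_zero]))
  have cj : ContinuousAt (fun q => ‖1728 * jInv q‖) 0 :=
    ((differentiableAt_jInv (by simp) (by simp [cuspFunction_E₄_zero])).continuousAt.const_mul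
      (1728 : ℂ)).norm
  have hj : ∀ᶠ q in 𝓝 (0 : ℂ), ‖1728 * jInv q‖ < 1 :=
    cj.eventually_lt_const (by simp [jInv_zero])
  obtain ⟨r, hr, h⟩ := Metric.eventually_nhds_iff_ball.mp (h4.and hj)
  refine ⟨min r 1, lt_min hr one_pos, min_le_right _ _, fun q hq => (h q ?_).1,
    fun q hq => (h q ?_).2⟩ <;>
  simpa using hq.trans_le (min_le_left _ _)

/-- The outer function of the Serre derivative of a hypergeometric candidate. -/
noncomputable def thetaShift (α : ℂ) (Φ : ℂ → ℂ) (x : ℂ) : ℂ := α * Φ x + x * deriv Φ x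

namespace IsSmallRadius

variable {r : ℝ} (hr : IsSmallRadius r)
include hr

lemma differentiableOn_jInv : DifferentiableOn ℂ jInv (Metric.ball 0 r) := fun q hq =>
  (differentiableAt_jInv ((mem_ball_zero_iff.mp hq).trans_le hr.le_one) (Complex.slitPlane_ne_zero
    (hr.slitPlane q (mem_ball_zero_iff.mp hq)))).differentiableWithinAt

lemma differentiableOn_hypergeometricCandidate (n : ℕ) (m : ℤ) {Φ : ℂ → ℂ}
    (hΦ : DifferentiableOn ℂ Φ (Metric.ball 0 1)) :
    DifferentiableOn ℂ (hypergeometricCandidate n m Φ) (Metric.ball 0 r) := by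
  have h4 : DifferentiableOn ℂ e₄ (Metric.ball 0 r) :=
    (IsHolomorphicAtCusp.modularForm E₄).differentiableOn.mono (Metric.ball_subset_ball hr.le_one)
  have hu : DifferentiableOn ℂ fourthRootE₄ (Metric.ball 0 r) := fun q hq =>
    ((h4 q hq).cpow_const (hr.slitPlane q (mem_ball_zero_iff.mp hq)))
  have hx : DifferentiableOn ℂ (fun q => 1728 * jInv q) (Metric.ball 0 r) :=
    hr.differentiableOn_jInv.const_mul _
  refine ((hr.differentiableOn_jInv.pow n).mul (hu.zpow (Or.inl fun q hq => ?_))).mul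
    (hΦ.comp hx fun q hq => ?_)
  · exact fourthRootE₄_ne_zero (Complex.slitPlane_ne_zero
      (hr.slitPlane q (mem_ball_zero_iff.mp hq)))
  · simpa using hr.norm_lt q (mem_ball_zero_iff.mp hq)

/-- 1/j = q + O(q²) supplies the order n with leading coefficient 1, and the fourth root of E₄ is 1
at the cusp. -/
lemma coeff_hypergeometricCandidate (n : ℕ) (m : ℤ) {Φ : ℂ → ℂ}
    (hΦ : DifferentiableOn ℂ Φ (Metric.ball 0 1)) :
    (∀ i < n, (taylorAtZero (hypergeometricCandidate n m Φ)).coeff i = 0) ∧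
      (taylorAtZero (hypergeometricCandidate n m Φ)).coeff n = Φ 0 := by
  have hm : Metric.ball (0 : ℂ) r ∈ 𝓝 (0 : ℂ) := Metric.ball_mem_nhds _ hr.pos
  have hj := hr.differentiableOn_jInv.analyticAt hm
  have hg := (hr.differentiableOn_hypergeometricCandidate 0 m hΦ).analyticAt hm
  have h : hypergeometricCandidate n m Φ = jInv ^ n * hypergeometricCandidate 0 m Φ := by
    ext q
    simp [hypergeometricCandidate, mul_assoc]
  obtain ⟨S, hS⟩ := PowerSeries.X_dvd_iff.mpr
    (show PowerSeries.constantCoeff (taylorAtZero jInv) = 0 by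
      rw [← PowerSeries.coeff_zero_eq_constantCoeff_apply, coeff_zero_taylorAtZero, jInv_zero])
  have hS0 : PowerSeries.constantCoeff S = 1 := by
    have h1 := coeff_one_taylorAtZero jInv
    rw [deriv_jInv_zero, hS, ← zero_add 1, PowerSeries.coeff_succ_X_mul] at h1
    simpa using h1
  have h0 : (taylorAtZero (hypergeometricCandidate 0 m Φ)).coeff 0 = Φ 0 := by
    rw [coeff_zero_taylorAtZero]
    simp [hypergeometricCandidate, jInv_zero, fourthRootE₄_zero]
  rw [h, taylorAtZero_mul (hj.pow n) hg, taylorAtZero_pow hj, hS, mul_pow, mul_assoc]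
  refine ⟨fun i hi => by rw [PowerSeries.coeff_X_pow_mul', if_neg (by lia)], ?_⟩
  rw [PowerSeries.coeff_X_pow_mul', if_pos le_rfl, Nat.sub_self]
  rw [PowerSeries.coeff_zero_eq_constantCoeff_apply] at h0 ⊢
  rw [map_mul, map_pow, hS0, one_pow, one_mul, h0]

/-- Thus the Serre derivative of weight m is E₆/E₄ times another candidate. For m = 6n ∓ 1 the shift
n − m/12 is (6n ± 1)/12, the first hypergeometric parameter a. -/
lemma hasThetaDerivAt_candidate (n : ℕ) (m : ℤ) {Φ : ℂ → ℂ}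
    (hΦ : DifferentiableOn ℂ Φ (Metric.ball 0 1)) {q : ℂ} (h0 : q ≠ 0) (hq : ‖q‖ < r) :
    HasThetaDerivAt (hypergeometricCandidate n m Φ) (m / 12 * e₂ q * hypergeometricCandidate n m Φ q
      + e₆ q / e₄ q * hypergeometricCandidate n m (thetaShift (n - m / 12) Φ) q) q := by
  have hd := (hΦ.differentiableAt (Metric.isOpen_ball.mem_nhds
    (mem_ball_zero_iff.mpr (hr.norm_lt q hq)))).hasDerivAt
  refine (hasThetaDerivAt_hypergeometricCandidate n m h0 (hq.trans_le hr.le_one)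
    (hr.slitPlane q hq) hd).congr_deriv ?_
  simp only [hypergeometricCandidate, thetaShift]
  ring

lemma hasThetaDerivAt_candidate_thetaShift (n : ℕ) (m : ℤ) (α : ℂ) {Φ : ℂ → ℂ}
    (hΦ : DifferentiableOn ℂ Φ (Metric.ball 0 1)) {q : ℂ} (h0 : q ≠ 0) (hq : ‖q‖ < r) :
    HasThetaDerivAt (hypergeometricCandidate n m (thetaShift α Φ))
      (jInv q ^ n * fourthRootE₄ q ^ m *
      ((n * (e₆ q / e₄ q) + m / 12 * (e₂ q - e₆ q / e₄ q)) *
          (α * Φ (1728 * jInv q) + 1728 * jInv q * deriv Φ (1728 * jInv q)) +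
        e₆ q / e₄ q * (1728 * jInv q * ((α + 1) * deriv Φ (1728 * jInv q) +
          1728 * jInv q * deriv (deriv Φ) (1728 * jInv q))))) q := by
  have hm : Metric.ball (0 : ℂ) 1 ∈ 𝓝 (1728 * jInv q) :=
    Metric.isOpen_ball.mem_nhds (mem_ball_zero_iff.mpr (hr.norm_lt q hq))
  have hd := (hΦ.differentiableAt hm).hasDerivAt
  have hd2 := ((hΦ.deriv Metric.isOpen_ball).differentiableAt hm).hasDerivAt
  have hs : HasDerivAt (thetaShift α Φ) ((α + 1) * deriv Φ (1728 * jInv q) +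
      1728 * jInv q * deriv (deriv Φ) (1728 * jInv q)) (1728 * jInv q) :=
    ((hd.const_mul α).add ((hasDerivAt_id _).mul hd2)).congr_deriv (by simp; ring)
  exact hasThetaDerivAt_hypergeometricCandidate n m h0 (hq.trans_le hr.le_one)
    (hr.slitPlane q hq) hs

lemma hasThetaDerivAt_div {q : ℂ} (h0 : q ≠ 0) (hq : ‖q‖ < r) :
    HasThetaDerivAt (fun q => e₆ q / e₄ q) (e₂ q * (e₆ q / e₄ q) / 6 - e₄ q / 2 +
      (e₆ q / e₄ q) ^ 2 / 3) q := by
  have hne := Complex.slitPlane_ne_zero (hr.slitPlane q hq)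
  have h1 := hq.trans_le hr.le_one
  refine ((hasThetaDerivAt_cuspFunction_E₆ h0 h1).div
    (hasThetaDerivAt_cuspFunction_E₄ h0 h1) hne).congr_deriv ?_
  field_simp
  ring

/-- Supplies the leading factor 1 − x of Gauss's equation. -/
lemma div_sq {q : ℂ} (hq : ‖q‖ < r) :
    (e₆ q / e₄ q) ^ 2 = (1 - 1728 * jInv q) * e₄ q := by
  have hne := Complex.slitPlane_ne_zero (hr.slitPlane q hq)
  rw [jInv]
  field_simp
  ring

/-- Differentiating E₆/E₄ adds (E₆/E₄)²/3, so the second derivative involves (x d/dx + b)(x d/dx +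
a)Φ with b = a + 1/3. After `div_sq`, the remaining discrepancy is a multiple of Gauss's equation.
-/
lemma hasThetaDerivAt_candidate_companion (n : ℕ) {a b c : ℂ} (ha : a = (6 * n + 1) / 12)
    (hb : b = (6 * n + 5) / 12) (hc : c = n + 1)
    (habc : ∀ k : ℕ, ↑k ≠ -a ∧ ↑k ≠ -b ∧ ↑k ≠ -c) {q : ℂ} (h0 : q ≠ 0) (hq : ‖q‖ < r) :
    HasThetaDerivAt (fun q => e₆ q / e₄ q *
        hypergeometricCandidate n (6 * n - 1) (thetaShift a (₂F₁ a b c)) q)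
      ((36 * n ^ 2 - 1) / 144 * e₄ q * hypergeometricCandidate n (6 * n - 1) (₂F₁ a b c) q +
        (6 * n + 1) / 12 * e₂ q * (e₆ q / e₄ q *
        hypergeometricCandidate n (6 * n - 1) (thetaShift a (₂F₁ a b c)) q)) q := by
  have hΦ := differentiableOn_ordinaryHypergeometric habc
  refine ((hr.hasThetaDerivAt_div h0 hq).mul
    (hr.hasThetaDerivAt_candidate_thetaShift n (6 * n - 1) a hΦ h0 hq)).congr_deriv ?_
  have ode := ordinaryHypergeometric_differential_equation habc (hr.norm_lt q hq)
  have hρ := hr.div_sq hq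
  simp only [hypergeometricCandidate, thetaShift]
  generalize e₆ q / e₄ q = ρ at *
  generalize jInv q ^ n * fourthRootE₄ q ^ (6 * n - 1 : ℤ) = C at *
  generalize deriv (deriv (₂F₁ a b c)) (1728 * jInv q) = Φ₂ at *
  generalize deriv (₂F₁ a b c) (1728 * jInv q) = Φ₁ at *
  generalize (₂F₁ a b c : ℂ → ℂ) (1728 * jInv q) = Φ at *
  generalize 1728 * jInv q = x at *
  subst ha hb hc
  push_cast
  linear_combination C * x * e₄ q * ode + C * ((n - (6 * n - 1) / 12 + 1 / 3) *
    ((6 * n + 1) / 12 * Φ + x * Φ₁) + x * ((6 * n + 1) / 12 * Φ₁ + Φ₁ + x * Φ₂)) * hρ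

/-- The extra division by E₄ contributes another 1/3, whence b = a + 2/3 here. -/
lemma hasThetaDerivAt_candidate_companion' (n : ℕ) {a b c : ℂ} (ha : a = (6 * n - 1) / 12)
    (hb : b = (6 * n + 7) / 12) (hc : c = n + 1)
    (habc : ∀ k : ℕ, ↑k ≠ -a ∧ ↑k ≠ -b ∧ ↑k ≠ -c) {q : ℂ} (h0 : q ≠ 0) (hq : ‖q‖ < r) :
    HasThetaDerivAt (fun q => e₆ q / e₄ q / e₄ q *
        hypergeometricCandidate n (6 * n + 1) (thetaShift a (₂F₁ a b c)) q)
      ((36 * n ^ 2 - 1) / 144 * hypergeometricCandidate n (6 * n + 1) (₂F₁ a b c) q +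
        (6 * n - 1) / 12 * e₂ q * (e₆ q / e₄ q / e₄ q *
        hypergeometricCandidate n (6 * n + 1) (thetaShift a (₂F₁ a b c)) q)) q := by
  have hΦ := differentiableOn_ordinaryHypergeometric habc
  have hne := Complex.slitPlane_ne_zero (hr.slitPlane q hq)
  refine (((hr.hasThetaDerivAt_div h0 hq).div
    (hasThetaDerivAt_cuspFunction_E₄ h0 (hq.trans_le hr.le_one)) hne).mul
    (hr.hasThetaDerivAt_candidate_thetaShift n (6 * n + 1) a hΦ h0 hq)).congr_deriv ?_
  have ode := ordinaryHypergeometric_differential_equation habc (hr.norm_lt q hq)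
  have hρ := hr.div_sq hq
  have h6 : e₆ q = e₆ q / e₄ q * e₄ q := by field_simp
  simp only [hypergeometricCandidate, thetaShift]
  generalize e₆ q / e₄ q = ρ at *
  rw [h6]
  generalize jInv q ^ n * fourthRootE₄ q ^ (6 * n + 1 : ℤ) = C at *
  generalize deriv (deriv (₂F₁ a b c)) (1728 * jInv q) = Φ₂ at *
  generalize deriv (₂F₁ a b c) (1728 * jInv q) = Φ₁ at *
  generalize (₂F₁ a b c : ℂ → ℂ) (1728 * jInv q) = Φ at *
  generalize 1728 * jInv q = x at *
  subst ha hb hc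
  push_cast
  field_simp
  linear_combination (C * (186624 * (n + n ^ 2) * Φ - 36288 * Φ +
    (746496 * n + 1119744) * x * Φ₁ + 746496 * x ^ 2 * Φ₂)) * hρ + 746496 * C * e₄ q * x * ode

end IsSmallRadius

/-! ### Identification of the extremal forms with the candidates. -/

lemma differentiableOn_thetaShift {Φ : ℂ → ℂ} (α : ℂ)
    (hΦ : DifferentiableOn ℂ Φ (Metric.ball 0 1)) :
    DifferentiableOn ℂ (thetaShift α Φ) (Metric.ball 0 1) :=
  (hΦ.const_mul α).add (differentiableOn_id.mul (hΦ.deriv Metric.isOpen_ball))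

lemma IsHolomorphicAtCusp.hasThetaDerivAt_of_serreDerivative {f : ℍ → ℂ}
    (hf : IsHolomorphicAtCusp f) (k : ℂ) {q : ℂ} (h0 : q ≠ 0) (h1 : ‖q‖ < 1) :
    HasThetaDerivAt (cuspFunction 1 f) (k / 12 * e₂ q * cuspFunction 1 f q +
      cuspFunction 1 (Derivative.serreDerivative k f) q) q := by
  obtain ⟨τ, rfl⟩ := exists_qParam_eq h0 h1
  refine (hf.hasThetaDerivAt τ).congr_deriv ?_
  rw [hf.cuspFunction_qParam, E2.cuspFunction_qParam,
    (hf.serreDerivative k).cuspFunction_qParam, serreDerivative_apply]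
  ring

lemma ne_neg_of_mod {p : ℤ} (hp : ¬ (12 : ℤ) ∣ p) (k : ℕ) : (k : ℂ) ≠ -((p : ℂ) / 12) := by
  intro h
  refine hp ⟨-k, ?_⟩
  have : (p : ℂ) = ((12 * -k : ℤ) : ℂ) := by
    push_cast
    linear_combination 12 * h
  exact_mod_cast this

lemma ne_neg_natCast_add_one (n k : ℕ) : (k : ℂ) ≠ -((n : ℂ) + 1) := by
  intro h
  have : ((k + n + 1 : ℕ) : ℂ) = 0 := by
    push_cast
    linear_combination h
  exact Nat.cast_ne_zero.mpr (Nat.succ_ne_zero (k + n)) this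

lemma hypergeometricP_params (n k : ℕ) : (k : ℂ) ≠ -((6 * n + 1) / 12) ∧
    (k : ℂ) ≠ -((6 * n + 5) / 12) ∧ (k : ℂ) ≠ -((n : ℂ) + 1) := by
  have h1 := ne_neg_of_mod (p := 6 * n + 1) (by lia) k
  have h2 := ne_neg_of_mod (p := 6 * n + 5) (by lia) k
  push_cast at h1 h2
  exact ⟨h1, h2, ne_neg_natCast_add_one n k⟩

lemma hypergeometricQ_params (n k : ℕ) : (k : ℂ) ≠ -((6 * n - 1) / 12) ∧
    (k : ℂ) ≠ -((6 * n + 7) / 12) ∧ (k : ℂ) ≠ -((n : ℂ) + 1) := by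
  have h1 := ne_neg_of_mod (p := 6 * n - 1) (by lia) k
  have h2 := ne_neg_of_mod (p := 6 * n + 7) (by lia) k
  push_cast at h1 h2
  exact ⟨h1, h2, ne_neg_natCast_add_one n k⟩

/-- The indicial polynomial of the Kaneko–Zagier equation is k(k − n). -/
lemma indicial_ne {n k : ℕ} (hk : n < k) : ((k : ℂ) - (6 * n - 1) / 12) * (k - (6 * n + 1) / 12) ≠
    (36 * n ^ 2 - 1) / 144 := by
  intro h
  have h1 : (k : ℂ) * (k - n) = 0 := by linear_combination h
  rcases mul_eq_zero.mp h1 with h2 | h2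
  · have : k = 0 := by exact_mod_cast h2
    lia
  · have : k = n := by exact_mod_cast sub_eq_zero.mp h2
    lia

namespace IsExtremalDepthLEOne

variable {r : ℝ} {n : ℕ} {f : ℍ → ℂ}

lemma coeff_sub_candidate {w : ℕ} (hf : IsExtremalDepthLEOne w f) (hw : w / 6 = n)
    (hr : IsSmallRadius r) (m : ℤ) {Φ : ℂ → ℂ} (hΦ : DifferentiableOn ℂ Φ (Metric.ball 0 1))
    (h1 : Φ 0 = 1) (i : ℕ) (hi : i ≤ n) :
    (taylorAtZero (cuspFunction 1 f - hypergeometricCandidate n m Φ)).coeff i = 0 := by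
  have hc := hr.coeff_hypergeometricCandidate n m hΦ
  have h2 := hf.coeff_eq_zero
  have h3 := hf.coeff_eq_one
  rw [hw] at h2 h3
  rw [taylorAtZero_sub hf.holomorphic.analyticAt_zero
    ((hr.differentiableOn_hypergeometricCandidate n m hΦ).analyticAt
      (Metric.ball_mem_nhds _ hr.pos)), ← qExpansion_eq_taylorAtZero, map_sub]
  rcases lt_or_eq_of_le hi with h | rfl
  · rw [h2 i h, hc.1 i h, sub_zero]
  · rw [h3, hc.2, h1, sub_self]

lemma eqOn_of_eventuallyEq (hf : IsHolomorphicAtCusp f) (hr : IsSmallRadius r) {g : ℂ → ℂ}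
    (hg : DifferentiableOn ℂ g (Metric.ball 0 r)) (h : cuspFunction 1 f - g =ᶠ[𝓝 0] 0) {q : ℂ}
    (hq : ‖q‖ < r) : cuspFunction 1 f q = g q := by
  have hd : DifferentiableOn ℂ (cuspFunction 1 f - g) (Metric.ball 0 r) :=
    (hf.differentiableOn.mono (Metric.ball_subset_ball hr.le_one)).sub hg
  exact sub_eq_zero.mp ((hd.analyticOnNhd
    Metric.isOpen_ball).eqOn_zero_of_preconnected_of_eventuallyEq_zero
    (convex_ball _ _).isPreconnected (by simpa using hr.pos) h (by simpa using hq))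

/-- The pairs (f, ϑ_{6n-1}f) and (candidate, companion) solve one system; their difference vanishes
through order n in the first component, past the largest exponent. -/
theorem cuspFunction_eq_candidate (hf : IsExtremalDepthLEOne (6 * n) f) (hr : IsSmallRadius r)
    {q : ℂ} (hq : ‖q‖ < r) : cuspFunction 1 f q = hypergeometricCandidate n (6 * n - 1)
      (₂F₁ ((6 * n + 1) / 12 : ℂ) ((6 * n + 5) / 12) (n + 1)) q := by
  have habc := hypergeometricP_params n
  have hΦ := differentiableOn_ordinaryHypergeometric habc
  have hcd := hr.differentiableOn_hypergeometricCandidate n (6 * n - 1) hΦ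
  have hfc := hf.holomorphic
  have hsc := hfc.serreDerivative (6 * n - 1)
  have hb : Metric.ball (0 : ℂ) r ∈ 𝓝 0 := Metric.ball_mem_nhds _ hr.pos
  have h6 := (IsHolomorphicAtCusp.modularForm E₆).analyticAt_zero
  have h4 := (IsHolomorphicAtCusp.modularForm E₄).analyticAt_zero
  have h2 := IsHolomorphicAtCusp.E2.analyticAt_zero
  have hz : AnalyticAt ℂ (fun q => e₆ q / e₄ q * hypergeometricCandidate n (6 * n - 1)
      (thetaShift ((6 * n + 1) / 12) (₂F₁ ((6 * n + 1) / 12 : ℂ) ((6 * n + 5) / 12) (n + 1))) q) 0 :=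
    (h6.div h4 (by simp [cuspFunction_E₄_zero])).mul
      ((hr.differentiableOn_hypergeometricCandidate n _
        (differentiableOn_thetaShift _ hΦ)).analyticAt hb)
  have hev : ∀ᶠ q : ℂ in 𝓝[≠] 0, q ≠ 0 ∧ ‖q‖ < r := by
    filter_upwards [self_mem_nhdsWithin, mem_nhdsWithin_of_mem_nhds hb] with q h0 hq
    exact ⟨h0, mem_ball_zero_iff.mp hq⟩
  refine eqOn_of_eventuallyEq hfc hr hcd (eventuallyEq_zero_of_system (n := n)
    (p₁ := fun q => (6 * n - 1) / 12 * e₂ q) (p₂ := fun _ => 1)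
    (p₃ := fun q => (36 * n ^ 2 - 1) / 144 * e₄ q) (p₄ := fun q => (6 * n + 1) / 12 * e₂ q)
    (hfc.analyticAt_zero.sub (hcd.analyticAt hb)) (hsc.analyticAt_zero.sub hz)
    (analyticAt_const.mul h2) analyticAt_const (analyticAt_const.mul h4) (analyticAt_const.mul h2)
    ?_ ?_ one_ne_zero (hf.coeff_sub_candidate (by lia) hr _ hΦ (ordinaryHypergeometric_zero _ _ _))
    ?_) hq
  · filter_upwards [hev] with q hq
    have d1 := hfc.hasThetaDerivAt_of_serreDerivative (6 * n - 1) hq.1 (hq.2.trans_le hr.le_one)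
    have d2 := hr.hasThetaDerivAt_candidate n (6 * n - 1) hΦ hq.1 hq.2
    rw [show (n : ℂ) - ((6 * n - 1 : ℤ) : ℂ) / 12 = (6 * n + 1) / 12 by push_cast; ring] at d2
    rw [(d1.sub d2).deriv_eq]
    simp only [Pi.sub_apply]
    push_cast
    ring
  · filter_upwards [hev] with q hq
    have d1 := hsc.hasThetaDerivAt_of_serreDerivative (6 * n + 1) hq.1 (hq.2.trans_le hr.le_one)
    have d2 := hr.hasThetaDerivAt_candidate_companion n rfl rfl rfl habc hq.1 hq.2
    rw [(d1.sub d2).deriv_eq]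
    have hE : cuspFunction 1 (serreDerivative (6 * n + 1) (serreDerivative (6 * n - 1) f)) q =
        (36 * n ^ 2 - 1) / 144 * (e₄ q * cuspFunction 1 f q) := by
      have hEc := (IsHolomorphicAtCusp.modularForm E₄).mul hfc
      rw [hf.serreDerivative_serreDerivative, cuspFunction_smul hEc.analyticAt_zero.continuousAt,
        cuspFunction_mul h4.continuousAt hfc.analyticAt_zero.continuousAt]
      rfl
    rw [hE]
    simp only [Pi.sub_apply]
    ring
  · intro k hk
    have := indicial_ne hk
    simpa [cuspFunction_E2_zero, cuspFunction_E₄_zero] using this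

/-- The second component is now (6n−1)/12·f: each of G_{6n} and G_{6n+2} is sent by the Serre
derivative to a multiple of the other, up to a factor E₄, so no new second order equation is needed.
-/
theorem cuspFunction_eq_candidate' (hf : IsExtremalDepthLEOne (6 * n) f) {g : ℍ → ℂ}
    (hg : IsExtremalDepthLEOne (6 * n + 2) g) (hr : IsSmallRadius r)
    {q : ℂ} (hq : ‖q‖ < r) : cuspFunction 1 g q = hypergeometricCandidate n (6 * n + 1)
      (₂F₁ ((6 * n - 1) / 12 : ℂ) ((6 * n + 7) / 12) (n + 1)) q := by
  have habc := hypergeometricQ_params n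
  have hΦ := differentiableOn_ordinaryHypergeometric habc
  have hcd := hr.differentiableOn_hypergeometricCandidate n (6 * n + 1) hΦ
  have hfc := hf.holomorphic
  have hgc := hg.holomorphic
  have hb : Metric.ball (0 : ℂ) r ∈ 𝓝 0 := Metric.ball_mem_nhds _ hr.pos
  have h6 := (IsHolomorphicAtCusp.modularForm E₆).analyticAt_zero
  have h4 := (IsHolomorphicAtCusp.modularForm E₄).analyticAt_zero
  have h2 := IsHolomorphicAtCusp.E2.analyticAt_zero
  have h40 : e₄ 0 ≠ 0 := by simp [cuspFunction_E₄_zero]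
  have hn : (6 * n + 1 : ℂ) ≠ 0 := by exact_mod_cast Nat.succ_ne_zero (6 * n)
  have hz : AnalyticAt ℂ (fun q => e₆ q / e₄ q / e₄ q * hypergeometricCandidate n (6 * n + 1)
      (thetaShift ((6 * n - 1) / 12) (₂F₁ ((6 * n - 1) / 12 : ℂ) ((6 * n + 7) / 12) (n + 1))) q) 0 :=
    ((h6.div h4 h40).div h4 h40).mul
      ((hr.differentiableOn_hypergeometricCandidate n _
        (differentiableOn_thetaShift _ hΦ)).analyticAt hb)
  have hsf : serreDerivative (6 * n - 1) f = ((6 * n + 1) / 12 : ℂ) • g := by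
    rw [hg.unique hf.serreDerivative_smul, smul_smul]
    rw [show ((6 * n + 1) / 12 * (12 / (6 * n + 1)) : ℂ) = 1 by field_simp, one_smul]
  -- The Kaneko–Zagier equation for f, with ϑf replaced by its multiple of g and 36n² − 1 factored
  -- as (6n+1)(6n−1).
  have hsg : serreDerivative (6 * n + 1) g = ((6 * n - 1) / 12 : ℂ) • (⇑E₄ * f) := by
    have h := hf.serreDerivative_serreDerivative
    rw [hsf, Derivative.serreDerivative_smul _ _ _ hgc.mdiff] at h
    have h' := congrArg (fun F : ℍ → ℂ => (12 / (6 * n + 1) : ℂ) • F) h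
    simp only [smul_smul] at h'
    rw [show (12 / (6 * n + 1) * ((6 * n + 1) / 12) : ℂ) = 1 by field_simp, one_smul] at h'
    rw [h']
    congr 1
    field_simp
    ring
  have hev : ∀ᶠ q : ℂ in 𝓝[≠] 0, q ≠ 0 ∧ ‖q‖ < r := by
    filter_upwards [self_mem_nhdsWithin, mem_nhdsWithin_of_mem_nhds hb] with q h0 hq
    exact ⟨h0, mem_ball_zero_iff.mp hq⟩
  refine eqOn_of_eventuallyEq hgc hr hcd (eventuallyEq_zero_of_system (n := n)
    (z := cuspFunction 1 (((6 * n - 1) / 12 : ℂ) • f) - _)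
    (p₁ := fun q => (6 * n + 1) / 12 * e₂ q) (p₂ := e₄)
    (p₃ := fun q => (36 * n ^ 2 - 1) / 144) (p₄ := fun q => (6 * n - 1) / 12 * e₂ q)
    (hgc.analyticAt_zero.sub (hcd.analyticAt hb)) ((hfc.smul _).analyticAt_zero.sub hz)
    (analyticAt_const.mul h2) h4 analyticAt_const (analyticAt_const.mul h2)
    ?_ ?_ h40 (hg.coeff_sub_candidate (by lia) hr _ hΦ (ordinaryHypergeometric_zero _ _ _))
    ?_) hq
  · filter_upwards [hev] with q hq
    have d1 := hgc.hasThetaDerivAt_of_serreDerivative (6 * n + 1) hq.1 (hq.2.trans_le hr.le_one)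
    have d2 := hr.hasThetaDerivAt_candidate n (6 * n + 1) hΦ hq.1 hq.2
    rw [show (n : ℂ) - ((6 * n + 1 : ℤ) : ℂ) / 12 = (6 * n - 1) / 12 by push_cast; ring] at d2
    have hE : cuspFunction 1 (serreDerivative (6 * n + 1) g) q =
        (6 * n - 1) / 12 * (e₄ q * cuspFunction 1 f q) := by
      have hEc := (IsHolomorphicAtCusp.modularForm E₄).mul hfc
      rw [hsg, cuspFunction_smul hEc.analyticAt_zero.continuousAt,
        cuspFunction_mul h4.continuousAt hfc.analyticAt_zero.continuousAt]
      rfl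
    have hne := Complex.slitPlane_ne_zero (hr.slitPlane q hq.2)
    rw [(d1.sub d2).deriv_eq, hE, cuspFunction_smul hfc.analyticAt_zero.continuousAt]
    simp only [Pi.sub_apply, Pi.smul_apply, smul_eq_mul]
    push_cast
    field_simp
    ring
  · filter_upwards [hev] with q hq
    have d1 := (hfc.hasThetaDerivAt_of_serreDerivative (6 * n - 1) hq.1
      (hq.2.trans_le hr.le_one)).const_mul ((6 * n - 1) / 12)
    have d2 := hr.hasThetaDerivAt_candidate_companion' n rfl rfl rfl habc hq.1 hq.2
    rw [hsf, cuspFunction_smul hgc.analyticAt_zero.continuousAt] at d1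
    rw [cuspFunction_smul hfc.analyticAt_zero.continuousAt]
    refine (d1.sub d2).deriv_eq.trans ?_
    simp only [Pi.sub_apply, Pi.smul_apply, smul_eq_mul]
    ring
  · intro k hk
    have := indicial_ne hk
    rw [mul_comm] at this
    simpa [cuspFunction_E2_zero, cuspFunction_E₄_zero] using this

end IsExtremalDepthLEOne

/-! ### The fourth root of E₄ as a hypergeometric series, and the conclusion. -/

lemma cuspFunction_one_eq_one {q : ℂ} (hq : ‖q‖ < 1) : cuspFunction 1 (1 : ℍ → ℂ) q = 1 := by
  have hc := IsExtremalDepthLEOne.one.holomorphic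
  have h := hasSum_qExpansion_of_norm_lt one_pos hc.periodic hc.mdiff hc.bounded hq
  rw [qExpansion_one] at h
  have h1 := hasSum_single (f := fun m : ℕ => (PowerSeries.coeff m) (1 : PowerSeries ℂ) • q ^ m) 0
    fun m hm => by simp [PowerSeries.coeff_one, hm]
  simpa using h.unique h1

/-- The case n = 0 of `cuspFunction_eq_candidate`: the extremal form is 1 and the candidate is
E₄^{-1/4}₂F₁. -/
lemma IsSmallRadius.fourthRootE₄_eq {r : ℝ} (hr : IsSmallRadius r) {q : ℂ} (hq : ‖q‖ < r) :
    fourthRootE₄ q = ₂F₁ (1 / 12 : ℂ) (5 / 12) 1 (1728 * jInv q) := by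
  have h := IsExtremalDepthLEOne.cuspFunction_eq_candidate (n := 0) IsExtremalDepthLEOne.one hr hq
  rw [cuspFunction_one_eq_one (hq.trans_le hr.le_one)] at h
  have hu := fourthRootE₄_ne_zero (Complex.slitPlane_ne_zero (hr.slitPlane q hq))
  simp only [hypergeometricCandidate, Nat.cast_zero, mul_zero, zero_add, zero_sub, pow_zero,
    one_mul, zpow_neg, zpow_one] at h
  field_simp at h
  convert h using 2

theorem mainTheorem2 :
    ∃ G : ℕ → ℍ → ℂ,
      -- `G w` is the normalized extremal quasimodular form of weight `w` and depth one;
      -- in weights `0` and `4` there is none and `1`, `E₄` are used by convention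
      (∀ w : ℕ, Even w → w ≠ 0 → w ≠ 4 → ∀ f : ℍ → ℂ, IsNormalizedExtremal w 1 f ↔ f = G w) ∧
      G 0 = 1 ∧
      G 4 = ⇑ModularForm.E₄ ∧
      (∃ Y : ℝ, ∀ τ : ℍ, Y < τ.im →
        -- all the series below converge
        1728 < ‖jInvariant τ‖ ∧
        ∀ n : ℕ,
          G (6 * n) τ = jInvariant τ ^ (-(n : ℤ)) *
            ₂F₁ (1 / 12 : ℂ) (5 / 12) 1 (1728 / jInvariant τ) ^ (2 * (3 * (n : ℤ) - 1)) *
            hypergeometricP n (1 / jInvariant τ) ∧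
          G (6 * n + 2) τ = jInvariant τ ^ (-(n : ℤ)) *
            ₂F₁ (1 / 12 : ℂ) (5 / 12) 1 (1728 / jInvariant τ) ^ (6 * n) *
            hypergeometricQ n (1 / jInvariant τ)) ∧
      ∀ (n : ℕ) (τ : ℍ), G (6 * n + 4) τ = ModularForm.E₄ τ * G (6 * n) τ := by
  choose! G hG using fun w => exists_isExtremalDepthLEOne (w := w)
  have h6 (n : ℕ) : IsExtremalDepthLEOne (6 * n) (G (6 * n)) := hG _ ⟨3 * n, by ring⟩
  have h62 (n : ℕ) : IsExtremalDepthLEOne (6 * n + 2) (G (6 * n + 2)) :=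
    hG _ ⟨3 * n + 1, by ring⟩
  have h64 (n : ℕ) : G (6 * n + 4) = ⇑E₄ * G (6 * n) :=
    (hG _ ⟨3 * n + 2, by ring⟩).unique (h6 n).E₄_mul
  have hG0 : G 0 = 1 := (h6 0).unique .one
  refine ⟨G, fun w hw h0 h4 f => ?_, hG0, ?_, ?_, fun n τ => congrFun (h64 n) τ⟩
  · rw [isNormalizedExtremal_iff hw h0 h4]
    refine ⟨fun h => h.unique (hG w hw), ?_⟩
    rintro rfl
    exact hG w hw
  · have := h64 0
    rwa [mul_zero, zero_add, hG0, mul_one] at this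
  obtain ⟨r, hr⟩ := exists_isSmallRadius
  -- This is the height at which |q| = exp(−2π Im τ) drops below r. The radius r does not involve n,
  -- so one Y serves all n.
  refine ⟨-Real.log r / (2 * Real.pi), fun τ hτ => ?_⟩
  have hq : ‖Periodic.qParam 1 (τ : ℂ)‖ < r := by
    rw [Periodic.norm_qParam, ← Real.lt_log_iff_exp_lt hr.pos, coe_im, div_one]
    rw [div_lt_iff₀ (by positivity)] at hτ
    linarith
  have hE : E₄ τ ≠ 0 := by
    have := Complex.slitPlane_ne_zero (hr.slitPlane _ hq)
    rwa [(IsHolomorphicAtCusp.modularForm E₄).cuspFunction_qParam] at this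
  have hj : jInvariant τ ≠ 0 := div_ne_zero (pow_ne_zero 3 hE) (discriminant_ne_zero τ)
  have hx := hr.norm_lt _ hq
  have hu := fourthRootE₄_ne_zero (Complex.slitPlane_ne_zero (hr.slitPlane _ hq))
  have hF := hr.fourthRootE₄_eq hq
  rw [jInv_qParam hE] at hx hF
  refine ⟨?_, fun n => ⟨?_, ?_⟩⟩
  · rw [mul_one_div, norm_div, div_lt_one (norm_pos_iff.mpr hj)] at hx
    simpa using hx
  -- Of the 6n − 1 factors E₄^{1/4}, one is the first factor of P_n, leaving the exponent 2(3n − 1).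
  -- For Q_n the split is 6n + 1 = 6n + 1·1, leaving 6n.
  · rw [← (h6 n).holomorphic.cuspFunction_qParam, (h6 n).cuspFunction_eq_candidate hr hq,
      hypergeometricCandidate, hypergeometricP, jInv_qParam hE, ← hF, ← mul_one_div 1728, ← hF,
      show (6 * n - 1 : ℤ) = 2 * (3 * n - 1) + 1 by ring, zpow_add_one₀ hu, one_div, inv_pow,
      zpow_neg, zpow_natCast]
    ring
  · rw [← (h62 n).holomorphic.cuspFunction_qParam, (h6 n).cuspFunction_eq_candidate' (h62 n) hr hq,
      hypergeometricCandidate, hypergeometricQ, jInv_qParam hE, ← hF, ← mul_one_div 1728, ← hF,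
      zpow_add_one₀ hu, one_div, inv_pow, zpow_neg, zpow_natCast]
    rw [show (6 * n : ℤ) = ((6 * n : ℕ) : ℤ) by push_cast; ring, zpow_natCast]
    ring
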